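/- Let $n\ge 1$ and let $M^{2n+1}$ be a smooth manifold (Hausdorff, second countable, without boundary) with a weak almost contact metric structure $(f,Q,\xi,\eta,g)$: $g$ is a smooth Riemannian metric, $f$ a smooth $(1,1)$-tensor of rank $2n$, $Q$ a smooth nonsingular $(1,1)$-tensor, $\xi$ a smooth vector field, $\eta$ a smooth 1-form, such that $f^2=-Q+\eta\otimes\xi$, $\eta(\xi)=1$, $Q\xi=\xi$, $g(fX,fY)=g(X,QY)-\eta(X)\eta(Y)$ for all smooth vector fields $X,Y$, and $\ker\eta$ is $f$-invariant. Suppose that the structure is weak $\beta$-Kenmotsu with a real constant $\beta\ne 0$, i.e. for the Levi-Civita connection $\nabla$ of $g$ $$(\nabla_X f)Y=\beta\{g(fX,Y)\,\xi-\eta(Y)\,fX\}\quad\text{for all smooth vector fields } X,Y.$$ Let $R_{X,Y}Z=\nabla_X\nabla_YZ-\nabla_Y\nabla_XZ-\nabla_{[X,Y]}Z$, $\operatorname{Ric}(X,Y)=\operatorname{trace}\{Z\mapsto R_{Z,X}Y\}$, let $r=\operatorname{trace}_g\operatorname{Ric}$ be the scalar curvature, and let $\operatorname{Ric}^\ast(X,Y)=\tfrac12\operatorname{trace}\{Z\mapsto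 R_{X,fY}fZ\}$ be the $\ast$-Ricci tensor. Suppose that a smooth vector field $V$ and real constants $\lambda,\mu$ satisfy the $\ast$-$\eta$-Ricci soliton equation $$\tfrac12\,\pounds_V g+\operatorname{Ric}^\ast=\lambda\,g+\mu\,\eta\otimes\eta,$$ where $\pounds$ is the Lie derivative, and that $V$ is a contact vector field: $\pounds_V\eta=\sigma\,\eta$ for some smooth function $\sigma$ on $M$. Then $V$ is strictly contact, i.e. $\sigma=0$, and $(M,g)$ is an Einstein manifold ($\operatorname{Ric}=c\,g$ for a real constant $c$) of scalar curvature $r=-2n(2n+1)\beta^2$. -/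

import Mathlib

open Bundle VectorField
open scoped Manifold ContDiff

noncomputable section

set_option linter.unusedSectionVars false

namespace RiemGeom

section LeviCivita

variable {E : Type*} [NormedAddCommGroup E] [NormedSpace ℝ E] [FiniteDimensional ℝ E]
  {H : Type*} [TopologicalSpace H] (I : ModelWithCorners ℝ E H)
  {M : Type*} [TopologicalSpace M] [ChartedSpace H M] [IsManifold I ∞ M]
  [RiemannianBundle (fun x : M => TangentSpace I x)]
  [IsContMDiffRiemannianBundle I ∞ E (fun x : M => TangentSpace I x)]

/-- The value at `x` of the right-hand side of the Koszul formula for `2 g(∇_X Y, Z)`. -/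
def koszul (Y X Z : Π x : M, TangentSpace I x) (x : M) : ℝ :=
  mvfderiv I (fun y => inner ℝ (Y y) (Z y)) x (X x)
  + mvfderiv I (fun y => inner ℝ (X y) (Z y)) x (Y x)
  - mvfderiv I (fun y => inner ℝ (X y) (Y y)) x (Z x)
  + inner ℝ (mlieBracket I X Y x) (Z x)
  - inner ℝ (mlieBracket I X Z x) (Y x)
  - inner ℝ (mlieBracket I Y Z x) (X x)

variable {I}

instance finiteDimensional_tangentSpace (x : M) : FiniteDimensional ℝ (TangentSpace I x) :=
  inferInstanceAs (FiniteDimensional ℝ E)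

theorem mdiff_inner {X Y : Π x : M, TangentSpace I x} {x : M}
    (hX : MDiffAt (T% X) x) (hY : MDiffAt (T% Y) x) :
    MDiffAt (fun y => inner ℝ (X y) (Y y)) x :=
  MDifferentiableAt.inner_bundle hX hY

theorem koszul_add_left {Y X X' Z : Π x : M, TangentSpace I x} {x : M} (hY : MDiffAt (T% Y) x)
    (hX : MDiffAt (T% X) x) (hX' : MDiffAt (T% X') x) (hZ : MDiffAt (T% Z) x) :
    koszul I Y (X + X') Z x = koszul I Y X Z x + koszul I Y X' Z x := by
  simp only [koszul, Pi.add_apply, inner_add_left, inner_add_right, map_add,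
    mlieBracket_add_left hX hX',
    mvfderiv_fun_add (mdiff_inner hX hZ) (mdiff_inner hX' hZ),
    mvfderiv_fun_add (mdiff_inner hX hY) (mdiff_inner hX' hY), _root_.add_apply]
  ring

theorem koszul_add_right {Y X Z Z' : Π x : M, TangentSpace I x} {x : M} (hY : MDiffAt (T% Y) x)
    (hX : MDiffAt (T% X) x) (hZ : MDiffAt (T% Z) x) (hZ' : MDiffAt (T% Z') x) :
    koszul I Y X (Z + Z') x = koszul I Y X Z x + koszul I Y X Z' x := by
  simp only [koszul, Pi.add_apply, inner_add_left, inner_add_right, map_add,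
    mlieBracket_add_right hZ hZ',
    mvfderiv_fun_add (mdiff_inner hX hZ) (mdiff_inner hX hZ'),
    mvfderiv_fun_add (mdiff_inner hY hZ) (mdiff_inner hY hZ'), _root_.add_apply]
  ring

theorem koszul_add_mid {Y Y' X Z : Π x : M, TangentSpace I x} {x : M} (hY : MDiffAt (T% Y) x)
    (hY' : MDiffAt (T% Y') x) (hX : MDiffAt (T% X) x) (hZ : MDiffAt (T% Z) x) :
    koszul I (Y + Y') X Z x = koszul I Y X Z x + koszul I Y' X Z x := by
  simp only [koszul, Pi.add_apply, inner_add_left, inner_add_right, map_add,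
    mlieBracket_add_right hY hY', mlieBracket_add_left hY hY',
    mvfderiv_fun_add (mdiff_inner hX hY) (mdiff_inner hX hY'),
    mvfderiv_fun_add (mdiff_inner hY hZ) (mdiff_inner hY' hZ), _root_.add_apply]
  ring

theorem koszul_smul_left {Y X Z : Π x : M, TangentSpace I x} {f : M → ℝ} {x : M}
    (hf : MDiffAt f x) (hY : MDiffAt (T% Y) x)
    (hX : MDiffAt (T% X) x) (hZ : MDiffAt (T% Z) x) :
    koszul I Y (f • X) Z x = f x * koszul I Y X Z x := by
  simp only [koszul, Pi.smul_apply', inner_add_left, inner_smul_left, inner_smul_right, map_smul,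
    mlieBracket_smul_left hf hX,
    mvfderiv_fun_mul hf (mdiff_inner hX hZ),
    mvfderiv_fun_mul hf (mdiff_inner hX hY), _root_.add_apply,
    _root_.smul_apply, smul_eq_mul, RCLike.conj_to_real, neg_smul, inner_neg_left]
  ring

theorem koszul_smul_right {Y X Z : Π x : M, TangentSpace I x} {f : M → ℝ} {x : M}
    (hf : MDiffAt f x) (hY : MDiffAt (T% Y) x)
    (hX : MDiffAt (T% X) x) (hZ : MDiffAt (T% Z) x) :
    koszul I Y X (f • Z) x = f x * koszul I Y X Z x := by
  simp only [koszul, Pi.smul_apply', inner_add_left, inner_smul_left, inner_smul_right, map_smul,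
    mlieBracket_smul_right hf hZ,
    mvfderiv_fun_mul hf (mdiff_inner hX hZ),
    mvfderiv_fun_mul hf (mdiff_inner hY hZ), _root_.add_apply,
    _root_.smul_apply, smul_eq_mul, RCLike.conj_to_real]
  rw [real_inner_comm (Y x) (Z x), real_inner_comm (X x) (Z x)]
  ring

theorem koszul_smul_mid {Y X Z : Π x : M, TangentSpace I x} {f : M → ℝ} {x : M}
    (hf : MDiffAt f x) (hY : MDiffAt (T% Y) x)
    (hX : MDiffAt (T% X) x) (hZ : MDiffAt (T% Z) x) :
    koszul I (f • Y) X Z x = f x * koszul I Y X Z x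
      + 2 * (mvfderiv I f x (X x) * inner ℝ (Y x) (Z x)) := by
  simp only [koszul, Pi.smul_apply', inner_add_left, inner_smul_left, inner_smul_right, map_smul,
    mlieBracket_smul_right hf hY, mlieBracket_smul_left hf hY,
    mvfderiv_fun_mul hf (mdiff_inner hX hY),
    mvfderiv_fun_mul hf (mdiff_inner hY hZ), _root_.add_apply,
    _root_.smul_apply, smul_eq_mul, RCLike.conj_to_real, neg_smul, inner_neg_left]
  rw [real_inner_comm (Y x) (X x)]
  ring

open Classical in
/-- The bilinear form `(u, w) ↦ 2 g(∇_u Y, w)` on `T_x M`, where `Y` is differentiable at `x`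
(and `0` as a default value otherwise). -/
def koszulForm (Y : Π x : M, TangentSpace I x) (x : M) :
    TangentSpace I x →L[ℝ] TangentSpace I x →L[ℝ] ℝ :=
  if hY : MDiffAt (T% Y) x then
    TensorialAt.mkHom₂ (I := I) (F := E) (F' := E) (koszul I Y · · x) x
      (fun _ hZ => ⟨fun hf hX => koszul_smul_left hf hY hX hZ,
        fun hX hX' => koszul_add_left hY hX hX' hZ⟩)
      (fun _ hX => ⟨fun hf hZ => koszul_smul_right hf hY hX hZ,
        fun hZ hZ' => koszul_add_right hY hX hZ hZ'⟩)
  else 0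

theorem koszulForm_apply {Y X Z : Π x : M, TangentSpace I x} {x : M} (hY : MDiffAt (T% Y) x)
    (hX : MDiffAt (T% X) x) (hZ : MDiffAt (T% Z) x) :
    koszulForm Y x (X x) (Z x) = koszul I Y X Z x := by
  rw [koszulForm, dif_pos hY]
  exact TensorialAt.mkHom₂_apply _ _ hX hZ

variable (I) in
/-- The covariant derivative of the Levi-Civita connection: `leviCivitaFun I Y x u` is `∇_u Y` at
`x`, i.e. the vector with `2 g(∇_u Y, w) = koszulForm Y x u w` for all `w`, written out in an
orthonormal basis of `T_x M`. -/
def leviCivitaFun (Y : Π x : M, TangentSpace I x) (x : M) :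
    TangentSpace I x →L[ℝ] TangentSpace I x :=
  ∑ i, ((2 : ℝ)⁻¹ • (koszulForm Y x).flip (stdOrthonormalBasis ℝ (TangentSpace I x) i)).smulRight
    (stdOrthonormalBasis ℝ (TangentSpace I x) i)

theorem inner_leviCivitaFun (Y : Π x : M, TangentSpace I x) (x : M) (u w : TangentSpace I x) :
    inner ℝ (leviCivitaFun I Y x u) w = 2⁻¹ * koszulForm Y x u w := by
  conv_rhs => rw [← (stdOrthonormalBasis ℝ (TangentSpace I x)).sum_repr' w]
  simp only [leviCivitaFun, _root_.sum_apply, ContinuousLinearMap.smulRight_apply,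
    _root_.smul_apply, ContinuousLinearMap.flip_apply, sum_inner, map_sum, map_smul,
    smul_eq_mul, inner_smul_left, RCLike.conj_to_real, Finset.mul_sum]
  exact Finset.sum_congr rfl fun i _ => by ring

theorem inner_leviCivitaFun_eq {Y X Z : Π x : M, TangentSpace I x} {x : M}
    (hY : MDiffAt (T% Y) x) (hX : MDiffAt (T% X) x) (hZ : MDiffAt (T% Z) x) :
    inner ℝ (leviCivitaFun I Y x (X x)) (Z x) = 2⁻¹ * koszul I Y X Z x := by
  rw [inner_leviCivitaFun, koszulForm_apply hY hX hZ]

theorem eq_of_inner_extend {x : M} {A B : TangentSpace I x →L[ℝ] TangentSpace I x}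
    (h : ∀ X Z : Π x : M, TangentSpace I x, MDiffAt (T% X) x → MDiffAt (T% Z) x →
      inner ℝ (A (X x)) (Z x) = inner ℝ (B (X x)) (Z x)) : A = B := by
  ext1 u
  refine ext_inner_right ℝ fun w => ?_
  simpa using h (FiberBundle.extend E u) (FiberBundle.extend E w)
    (FiberBundle.mdifferentiableAt_extend ..) (FiberBundle.mdifferentiableAt_extend ..)

variable (I M) in
/-- The Levi-Civita connection of the Riemannian metric. -/
def leviCivita : CovariantDerivative I E (fun x : M => TangentSpace I x) where
  toFun := leviCivitaFun I
  isCovariantDerivativeOnUniv :=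
    { add := by
        intro Y Y' x hY hY' _
        refine eq_of_inner_extend fun X Z hX hZ => ?_
        rw [inner_leviCivitaFun_eq (mdifferentiableAt_add_section hY hY') hX hZ,
          _root_.add_apply, inner_add_left, inner_leviCivitaFun_eq hY hX hZ,
          inner_leviCivitaFun_eq hY' hX hZ, koszul_add_mid hY hY' hX hZ]
        ring
      leibniz := by
        intro Y f x hY hf _
        refine eq_of_inner_extend fun X Z hX hZ => ?_
        rw [inner_leviCivitaFun_eq (hf.smul_section hY) hX hZ,
          _root_.add_apply, inner_add_left, _root_.smul_apply,
          inner_smul_left, ContinuousLinearMap.smulRight_apply, inner_smul_left,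
          inner_leviCivitaFun_eq hY hX hZ, koszul_smul_mid hf hY hX hZ]
        simp only [RCLike.conj_to_real]
        ring }

theorem inner_leviCivita {Y X Z : Π x : M, TangentSpace I x} {x : M}
    (hY : MDiffAt (T% Y) x) (hX : MDiffAt (T% X) x) (hZ : MDiffAt (T% Z) x) :
    inner ℝ (leviCivita I M Y x (X x)) (Z x) = 2⁻¹ * koszul I Y X Z x :=
  inner_leviCivitaFun_eq hY hX hZ

/-- The Levi-Civita connection is compatible with the metric. -/
theorem leviCivita_metric {X Y Z : Π x : M, TangentSpace I x} {x : M}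
    (hX : MDiffAt (T% X) x) (hY : MDiffAt (T% Y) x) (hZ : MDiffAt (T% Z) x) :
    mvfderiv I (fun y => inner ℝ (Y y) (Z y)) x (X x)
      = inner ℝ (leviCivita I M Y x (X x)) (Z x) + inner ℝ (Y x) (leviCivita I M Z x (X x)) := by
  rw [inner_leviCivita hY hX hZ, real_inner_comm _ (Y x), inner_leviCivita hZ hX hY]
  simp only [koszul, mlieBracket_swap_apply (V := Z) (W := Y), inner_neg_left,
    fun y => real_inner_comm (Y y) (Z y)]
  ring

/-- The Levi-Civita connection is torsion-free. -/
theorem leviCivita_torsionFree {X Y : Π x : M, TangentSpace I x} {x : M}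
    (hX : MDiffAt (T% X) x) (hY : MDiffAt (T% Y) x) :
    leviCivita I M Y x (X x) - leviCivita I M X x (Y x) = mlieBracket I X Y x := by
  refine ext_inner_right ℝ fun w => ?_
  have hW : MDiffAt (T% (FiberBundle.extend E w)) x := FiberBundle.mdifferentiableAt_extend ..
  have h1 := inner_leviCivita hY hX hW
  have h2 := inner_leviCivita hX hY hW
  rw [FiberBundle.extend_apply_self] at h1 h2
  rw [inner_sub_left, h1, h2]
  simp only [koszul, mlieBracket_swap_apply (V := Y) (W := X), inner_neg_left,
    fun y => real_inner_comm (Y y) (X y), FiberBundle.extend_apply_self]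
  ring

end LeviCivita

section Curvature

variable {E : Type*} [NormedAddCommGroup E] [NormedSpace ℝ E] [FiniteDimensional ℝ E]
  {H : Type*} [TopologicalSpace H] (I : ModelWithCorners ℝ E H)
  {M : Type*} [TopologicalSpace M] [ChartedSpace H M] [IsManifold I ∞ M]
  [RiemannianBundle (fun x : M => TangentSpace I x)]
  [IsContMDiffRiemannianBundle I ∞ E (fun x : M => TangentSpace I x)]

/-- `X` is a smooth vector field on `M`. -/
def IsSmoothField (X : Π x : M, TangentSpace I x) : Prop := CMDiff ∞ (T% X)

/-- The vector field `∇_X Y`. -/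
def nabla (X Y : Π x : M, TangentSpace I x) : Π x : M, TangentSpace I x :=
  fun x => leviCivita I M Y x (X x)

/-- The curvature `R_{X,Y} Z = ∇_X ∇_Y Z - ∇_Y ∇_X Z - ∇_{[X,Y]} Z` on vector fields. -/
def curvature (X Y Z : Π x : M, TangentSpace I x) : Π x : M, TangentSpace I x :=
  nabla I X (nabla I Y Z) - nabla I Y (nabla I X Z) - nabla I (mlieBracket I X Y) Z

/-- The curvature tensor at a point: `R_{u,v} w` for tangent vectors `u, v, w` at `x`, computed on
their extensions to vector fields that are smooth near `x` (the result does not depend on the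
extensions, as the curvature is tensorial). -/
def curvatureAt {x : M} (u v w : TangentSpace I x) : TangentSpace I x :=
  curvature I (FiberBundle.extend E u) (FiberBundle.extend E v) (FiberBundle.extend E w) x

/-- The trace of an endomorphism of the Euclidean space `T_x M`, in an orthonormal basis. -/
def traceAt {x : M} (A : TangentSpace I x → TangentSpace I x) : ℝ :=
  ∑ i, inner ℝ (A (stdOrthonormalBasis ℝ (TangentSpace I x) i))
    (stdOrthonormalBasis ℝ (TangentSpace I x) i)

/-- The Ricci tensor `Ric(u, v) = trace (z ↦ R_{z,u} v)`. -/
def ricci {x : M} (u v : TangentSpace I x) : ℝ :=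
  traceAt I fun z => curvatureAt I z u v

/-- The scalar curvature, the metric trace of the Ricci tensor. -/
def scalarCurvature (x : M) : ℝ :=
  ∑ i, ricci I (stdOrthonormalBasis ℝ (TangentSpace I x) i)
    (stdOrthonormalBasis ℝ (TangentSpace I x) i)

variable (M) in
/-- The metric is Einstein: `Ric = c g` for a real constant `c`. -/
def IsEinstein : Prop :=
  ∃ c : ℝ, ∀ (x : M) (u v : TangentSpace I x), ricci I u v = c * inner ℝ u v

/-- The Lie derivative of the metric,
`(£_V g)(X, Y) = V(g(X, Y)) - g([V, X], Y) - g(X, [V, Y])`. -/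
def lieDerivMetric (V X Y : Π x : M, TangentSpace I x) (x : M) : ℝ :=
  mvfderiv I (fun y => inner ℝ (X y) (Y y)) x (V x)
    - inner ℝ (mlieBracket I V X x) (Y x) - inner ℝ (X x) (mlieBracket I V Y x)

/-- The Lie derivative of a one-form, `(£_V η)(Y) = V(η(Y)) - η([V, Y])`. -/
def lieDerivForm (V : Π x : M, TangentSpace I x) (η : Π x : M, TangentSpace I x →L[ℝ] ℝ)
    (Y : Π x : M, TangentSpace I x) (x : M) : ℝ :=
  mvfderiv I (fun y => η y (Y y)) x (V x) - η x (mlieBracket I V Y x)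

/-- The covariant derivative of a `(1,1)`-tensor field, `(∇_X f) Y = ∇_X (f Y) - f (∇_X Y)`. -/
def nablaEndo (f : Π x : M, TangentSpace I x →L[ℝ] TangentSpace I x)
    (X Y : Π x : M, TangentSpace I x) (x : M) : TangentSpace I x :=
  nabla I X (fun y => f y (Y y)) x - f x (nabla I X Y x)

end Curvature

section WeakContact

variable {E : Type*} [NormedAddCommGroup E] [NormedSpace ℝ E] [FiniteDimensional ℝ E]
  {H : Type*} [TopologicalSpace H] (I : ModelWithCorners ℝ E H)
  (M : Type*) [TopologicalSpace M] [ChartedSpace H M] [IsManifold I ∞ M]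
  [RiemannianBundle (fun x : M => TangentSpace I x)]
  [IsContMDiffRiemannianBundle I ∞ E (fun x : M => TangentSpace I x)]

/-- A weak almost contact metric structure `(f, Q, ξ, η, g)`, where `g` is the Riemannian metric
carried by `M` and `f` has rank `2n`. -/
structure WeakAlmostContactMetric (n : ℕ) where
  f : Π x : M, TangentSpace I x →L[ℝ] TangentSpace I x
  Q : Π x : M, TangentSpace I x →L[ℝ] TangentSpace I x
  ξ : Π x : M, TangentSpace I x
  η : Π x : M, TangentSpace I x →L[ℝ] ℝ
  smooth_f : ContMDiff I (I.prod 𝓘(ℝ, E →L[ℝ] E)) ∞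
    (fun x => TotalSpace.mk' (E →L[ℝ] E)
      (E := fun x : M => TangentSpace I x →L[ℝ] TangentSpace I x) x (f x))
  smooth_Q : ContMDiff I (I.prod 𝓘(ℝ, E →L[ℝ] E)) ∞
    (fun x => TotalSpace.mk' (E →L[ℝ] E)
      (E := fun x : M => TangentSpace I x →L[ℝ] TangentSpace I x) x (Q x))
  smooth_ξ : ContMDiff I (I.prod 𝓘(ℝ, E)) ∞
    (fun x => TotalSpace.mk' E (E := fun x : M => TangentSpace I x) x (ξ x))
  smooth_η : ContMDiff I (I.prod 𝓘(ℝ, E →L[ℝ] ℝ)) ∞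
    (fun x => TotalSpace.mk' (E →L[ℝ] ℝ)
      (E := fun x : M => TangentSpace I x →L[ℝ] Bundle.Trivial M ℝ x) x (η x))
  rank_f : ∀ x, Module.finrank ℝ (LinearMap.range (f x : TangentSpace I x →ₗ[ℝ] TangentSpace I x))
    = 2 * n
  Q_nonsingular : ∀ x, Function.Bijective (Q x)
  f_sq : ∀ x (u : TangentSpace I x), f x (f x u) = -Q x u + η x u • ξ x
  η_ξ : ∀ x, η x (ξ x) = 1
  Q_ξ : ∀ x, Q x (ξ x) = ξ x
  metric_f : ∀ x (u v : TangentSpace I x),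
    inner ℝ (f x u) (f x v) = inner ℝ u (Q x v) - η x u * η x v
  f_invariant : ∀ x (u : TangentSpace I x), η x u = 0 → η x (f x u) = 0

namespace WeakAlmostContactMetric

variable {I M} {n : ℕ} (S : WeakAlmostContactMetric I M n)

/-- The structure is weak `β`-Kenmotsu, for a nonzero constant `β`:
`(∇_X f) Y = β (g(f X, Y) ξ - η(Y) f X)` for all smooth vector fields `X, Y`. -/
def IsWeakKenmotsu (β : ℝ) : Prop :=
  β ≠ 0 ∧ ∀ X Y : Π x : M, TangentSpace I x, IsSmoothField I X → IsSmoothField I Y →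
    ∀ x, nablaEndo I S.f X Y x
      = β • (inner ℝ (S.f x (X x)) (Y x) • S.ξ x - S.η x (Y x) • S.f x (X x))

/-- The `∗`-Ricci tensor `Ric^∗(u, v) = (1/2) trace (z ↦ R_{u, f v} (f z))`. -/
def starRicci {x : M} (u v : TangentSpace I x) : ℝ :=
  (1 / 2) * traceAt I fun z => curvatureAt I u (S.f x v) (S.f x z)

/-- The metric, the vector field `V` and the constants `lam`, `mu` form a `∗`-`η`-Ricci soliton:
`(1/2) £_V g + Ric^∗ = lam g + mu η ⊗ η`. -/
def IsStarEtaRicciSoliton (V : Π x : M, TangentSpace I x) (lam mu : ℝ) : Prop :=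
  ∀ X Y : Π x : M, TangentSpace I x, IsSmoothField I X → IsSmoothField I Y →
    ∀ x, (1 / 2) * lieDerivMetric I V X Y x + S.starRicci (X x) (Y x)
      = lam * inner ℝ (X x) (Y x) + mu * (S.η x (X x) * S.η x (Y x))

/-- `£_V η = σ η` for the function `σ`. -/
def IsContactWith (V : Π x : M, TangentSpace I x) (σ : M → ℝ) : Prop :=
  ∀ Y : Π x : M, TangentSpace I x, IsSmoothField I Y →
    ∀ x, lieDerivForm I V S.η Y x = σ x * S.η x (Y x)

end WeakAlmostContactMetric

end WeakContact

end RiemGeom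

end

/-!
The argument lives in the algebra of smooth functions and vector fields, so the rules it uses are
collected in `RiemannianCalculus` and `WeakKenmotsuCalculus`; the smooth objects on a manifold
satisfy them by `calculus` and `kenmotsuCalculus`.

On a weak `β`-Kenmotsu manifold `∇_X ξ = β (X - η(X) ξ)`. Consequently the plane sections through
`ξ` have curvature `-β²`, and the Lie derivatives along `ξ` are explicit: `£_ξ η = 0`,
`£_ξ g = 2 β (g - η ⊗ η)`, `£_ξ f = 0`. The second Bianchi identity gives `£_ξ R`, and tracing it
against `f` gives `£_ξ Ric^∗ = 2 β³ g(·, f² ·)` (`ev_D_ξ_traceForm`).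

Inserting `ξ` into the soliton equation and into `£_V η = σ η` shows that `σ = lam + mu` is
constant and that `[ξ, V] = σ ξ`. Differentiating the soliton equation along `ξ` and eliminating
`V` by means of the equation itself then leaves the algebraic identity
`2 β³ g(·, f² ·) = 2 β Ric^∗ - σ β (g - η ⊗ η)` (`algebraic_T`). Differentiating this identity along
`ξ` once more turns both `2 β³ g(·, f² ·)` and `2 β Ric^∗` into `4 β⁴ g(·, f² ·)`. Only
`2 β² σ (g - η ⊗ η) = 0` remains, so `σ = 0` (`factor_mul`), and `Ric^∗ = β² g(·, f² ·)`.

The defect `D` of the curvature from constant curvature `-β²` has the symmetries of a curvature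
tensor, vanishes on `ξ`, and commutes with `f` by the Ricci identity for `f`. The first Bianchi
identity therefore expresses `Ric^∗(X, Y)` through the Ricci trace of `D` at `(X, f² Y)`
(`ev_traceForm_f`), and the value of `Ric^∗` just found makes this trace vanish on the image of
`f²`. Together with `ξ` this image spans the tangent space, because `Q` is invertible. So `D` has no
Ricci trace, and the Ricci tensor is that of constant curvature `-β²`, namely `-2 n β² g`.
-/

set_option linter.unusedSectionVars false

noncomputable section

/-! ### Riemannian calculus over a commutative ring -/

/-- The pair symmetry of a quadrilinear form follows from its other curvature symmetries. -/
theorem curvature_pair_symm {α C : Type*} [CommRing C] [Algebra ℝ C] {r : α → α → α → α → C}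
    (h₁ : ∀ X Y Z W, r X Y Z W = -r Y X Z W) (h₂ : ∀ X Y Z W, r X Y Z W = -r X Y W Z)
    (h₃ : ∀ X Y Z W, r X Y Z W + r Y Z X W + r Z X Y W = 0) (X Y Z W : α) :
    r X Y Z W = r Z W X Y := by
  have h : (2 : ℝ) • (r X Y Z W - r Z W X Y) = 0 := by
    rw [Algebra.smul_def, map_ofNat]
    have a1 := h₃ X Y Z W
    have a2 := h₃ Y Z W X
    have a3 := h₃ Z W X Y
    have a4 := h₃ W X Y Z
    grind
  exact sub_eq_zero.1 ((smul_eq_zero.1 h).resolve_left two_ne_zero)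

/-- The algebraic rules of Riemannian calculus, for a commutative `ℝ`-algebra `C` (the smooth
functions) and a `C`-module `𝔛` (the smooth vector fields): `D X` is the derivation along `X`,
`ip` the metric and `nab` its Levi-Civita connection. The Lie bracket is not part of the data, since
by vanishing of the torsion it is `nab X Y - nab Y X`. -/
structure RiemannianCalculus (C 𝔛 : Type*) [CommRing C] [Algebra ℝ C] [AddCommGroup 𝔛]
    [Module C 𝔛] where
  D : 𝔛 →ₗ[C] Derivation ℝ C C
  nab : 𝔛 →ₗ[C] (𝔛 →+ 𝔛)
  ip : 𝔛 →ₗ[C] 𝔛 →ₗ[C] C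
  ip_comm : ∀ X Y, ip X Y = ip Y X
  ip_nondeg : ∀ X, (∀ Y, ip X Y = 0) → X = 0
  nab_smul : ∀ X (c : C) Y, nab X (c • Y) = c • nab X Y + D X c • Y
  metric : ∀ X Y Z, D X (ip Y Z) = ip (nab X Y) Z + ip Y (nab X Z)
  D_torsion : ∀ X Y c, D (nab X Y - nab Y X) c = D X (D Y c) - D Y (D X c)
  jacobi : ∀ X Y Z, (nab X (nab Y Z - nab Z Y) - nab (nab Y Z - nab Z Y) X)
    = (nab (nab X Y - nab Y X) Z - nab Z (nab X Y - nab Y X))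
      + (nab Y (nab X Z - nab Z X) - nab (nab X Z - nab Z X) Y)

namespace RiemannianCalculus

variable {C 𝔛 : Type*} [CommRing C] [Algebra ℝ C] [AddCommGroup 𝔛] [Module C 𝔛]
  (G : RiemannianCalculus C 𝔛)

/-- The Lie bracket. -/
def br (X Y : 𝔛) : 𝔛 := G.nab X Y - G.nab Y X

theorem br_self (X : 𝔛) : G.br X X = 0 := sub_self _

theorem br_swap (X Y : 𝔛) : G.br X Y = -G.br Y X := (neg_sub _ _).symm

theorem D_br (X Y : 𝔛) (c : C) : G.D (G.br X Y) c = G.D X (G.D Y c) - G.D Y (G.D X c) :=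
  G.D_torsion X Y c

theorem br_jacobi (X Y Z : 𝔛) :
    G.br X (G.br Y Z) = G.br (G.br X Y) Z + G.br Y (G.br X Z) := G.jacobi X Y Z

theorem br_smul_right (X Y : 𝔛) (c : C) : G.br X (c • Y) = c • G.br X Y + G.D X c • Y := by
  simp only [br, G.nab_smul, map_smul, AddMonoidHom.smul_apply]
  module

theorem br_smul_left (X Y : 𝔛) (c : C) : G.br (c • X) Y = c • G.br X Y - G.D Y c • X := by
  rw [br_swap, br_smul_right, br_swap G Y X]
  module

theorem br_add_right (X Y Z : 𝔛) : G.br X (Y + Z) = G.br X Y + G.br X Z := by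
  simp only [br, map_add, AddMonoidHom.add_apply]
  abel

theorem br_add_left (X Y Z : 𝔛) : G.br (X + Y) Z = G.br X Z + G.br Y Z := by
  simp only [br, map_add, AddMonoidHom.add_apply]
  abel

/-- The curvature `R_{X,Y} Z` as a `C`-trilinear map. -/
def Rm : 𝔛 →ₗ[C] 𝔛 →ₗ[C] 𝔛 →ₗ[C] 𝔛 :=
  LinearMap.mk₂ C
    (fun X Y =>
      { toFun := fun Z => G.nab X (G.nab Y Z) - G.nab Y (G.nab X Z) - G.nab (G.br X Y) Z
        map_add' := fun Z W => by
          simp only [map_add]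
          abel
        map_smul' := fun c Z => by
          simp only [G.nab_smul, map_add, G.D_br, RingHom.id_apply]
          module })
    (fun X X' Y => by
      ext Z
      simp only [LinearMap.coe_mk, AddHom.coe_mk, LinearMap.add_apply, br_add_left, map_add,
        AddMonoidHom.add_apply]
      abel)
    (fun c X Y => by
      ext Z
      simp only [LinearMap.coe_mk, AddHom.coe_mk, LinearMap.smul_apply, br_smul_left, map_sub,
        map_smul, AddMonoidHom.smul_apply, AddMonoidHom.sub_apply, G.nab_smul]
      module)
    (fun X Y Y' => by
      ext Z
      simp only [LinearMap.coe_mk, AddHom.coe_mk, LinearMap.add_apply, br_add_right, map_add,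
        AddMonoidHom.add_apply]
      abel)
    (fun c X Y => by
      ext Z
      simp only [LinearMap.coe_mk, AddHom.coe_mk, LinearMap.smul_apply, br_smul_right, map_add,
        map_smul, AddMonoidHom.smul_apply, AddMonoidHom.add_apply, G.nab_smul]
      module)

theorem Rm_apply (X Y Z : 𝔛) :
    G.Rm X Y Z = G.nab X (G.nab Y Z) - G.nab Y (G.nab X Z) - G.nab (G.br X Y) Z := rfl

theorem Rm_swap (X Y Z : 𝔛) : G.Rm X Y Z = -G.Rm Y X Z := by
  simp only [Rm_apply, br_swap G Y X, map_neg, AddMonoidHom.neg_apply]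
  abel

theorem ip_Rm_swap (X Y Z W : 𝔛) : G.ip (G.Rm X Y Z) W = -G.ip (G.Rm X Y W) Z := by
  have h := G.D_br X Y (G.ip Z W)
  simp only [G.metric, map_add] at h
  rw [G.ip_comm (G.Rm X Y W)]
  simp only [Rm_apply, map_sub, LinearMap.sub_apply]
  linear_combination -h

/-- The first Bianchi identity. -/
theorem bianchi_first (X Y Z : 𝔛) : G.Rm X Y Z + G.Rm Y Z X + G.Rm Z X Y = 0 := by
  have h := G.br_jacobi X Y Z
  simp only [Rm_apply]
  simp only [br, map_sub, AddMonoidHom.sub_apply] at h ⊢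
  rw [← sub_eq_zero] at h
  rw [← h]
  abel

/-- The second Bianchi identity: the cyclic sum over `X`, `Y`, `Z` of `(∇_X R)_{Y,Z} W`, where the
derivatives of `Y` and `Z` combine to brackets since there is no torsion. -/
theorem bianchi_second (X Y Z W : 𝔛) :
    (G.nab X (G.Rm Y Z W) - G.Rm Y Z (G.nab X W) - G.Rm (G.br X Y) Z W)
    + (G.nab Y (G.Rm Z X W) - G.Rm Z X (G.nab Y W) - G.Rm (G.br Y Z) X W)
    + (G.nab Z (G.Rm X Y W) - G.Rm X Y (G.nab Z W) - G.Rm (G.br Z X) Y W) = 0 := by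
  have h : G.nab (G.br (G.br X Y) Z) W + G.nab (G.br (G.br Y Z) X) W
      + G.nab (G.br (G.br Z X) Y) W = 0 := by
    have := G.br_jacobi X Y Z
    rw [← AddMonoidHom.add_apply, ← AddMonoidHom.add_apply, ← map_add, ← map_add,
      br_swap G (G.br Y Z) X, this, br_swap G (G.br Z X) Y, br_swap G Z X]
    have h2 : G.br Y (-G.br X Z) = -G.br Y (G.br X Z) := by
      simp only [br, map_neg, AddMonoidHom.neg_apply]
      abel
    rw [h2]
    simp
  simp only [Rm_apply, map_sub]
  rw [← h]
  abel

end RiemannianCalculus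

/-! ### The weak Kenmotsu condition -/

/-- The algebraic rules of a weak `β`-Kenmotsu structure, with the one-form `η` written as
`ip · ξ` and the tensor `Q` eliminated through `f ∘ f = -Q + η ⊗ ξ`. -/
structure WeakKenmotsuCalculus {C 𝔛 : Type*} [CommRing C] [Algebra ℝ C] [AddCommGroup 𝔛]
    [Module C 𝔛] (G : RiemannianCalculus C 𝔛) where
  f : 𝔛 →ₗ[C] 𝔛
  ξ : 𝔛
  β : C
  D_β : ∀ X, G.D X β = 0
  ip_f : ∀ X Y, G.ip (f X) Y = -G.ip X (f Y)
  f_ξ : f ξ = 0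
  ip_ξ_ξ : G.ip ξ ξ = 1
  nab_f : ∀ X Y, G.nab X (f Y) = f (G.nab X Y) + β • (G.ip (f X) Y • ξ - G.ip Y ξ • f X)
  nab_ξ : ∀ X, G.nab X ξ = β • (X - G.ip X ξ • ξ)

namespace WeakKenmotsuCalculus

variable {C 𝔛 : Type*} [CommRing C] [Algebra ℝ C] [AddCommGroup 𝔛] [Module C 𝔛]
  {G : RiemannianCalculus C 𝔛} (S : WeakKenmotsuCalculus G)

theorem ip_f_ξ (X : 𝔛) : G.ip (S.f X) S.ξ = 0 := by rw [S.ip_f, S.f_ξ, map_zero, neg_zero]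

theorem ip_ξ_f (X : 𝔛) : G.ip S.ξ (S.f X) = 0 := by rw [G.ip_comm, S.ip_f_ξ]

theorem nab_β_smul (X Y : 𝔛) : G.nab X (S.β • Y) = S.β • G.nab X Y := by
  rw [G.nab_smul, S.D_β, zero_smul, add_zero]

theorem nab_ξ_f (X : 𝔛) : G.nab S.ξ (S.f X) = S.f (G.nab S.ξ X) := by
  rw [S.nab_f, S.f_ξ]
  simp

theorem br_ξ_f (X : 𝔛) : G.br S.ξ (S.f X) = S.f (G.br S.ξ X) := by
  simp only [RiemannianCalculus.br, S.nab_ξ_f, S.nab_ξ, S.ip_f_ξ, map_sub, map_smul, S.f_ξ]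
  module

/-- The Lie derivative of the metric along `ξ` is `2 β (g - η ⊗ η)`. -/
theorem D_ξ_ip (X Y : 𝔛) : G.D S.ξ (G.ip X Y) = G.ip (G.br S.ξ X) Y + G.ip X (G.br S.ξ Y)
    + 2 * S.β * (G.ip X Y - G.ip X S.ξ * G.ip Y S.ξ) := by
  rw [G.metric]
  simp only [RiemannianCalculus.br, S.nab_ξ, map_sub, map_smul, LinearMap.sub_apply,
    LinearMap.smul_apply, smul_eq_mul]
  rw [G.ip_comm S.ξ Y]
  ring

/-- The one-form `η` is invariant along `ξ`. -/
theorem D_ξ_ip_ξ (X : 𝔛) : G.D S.ξ (G.ip X S.ξ) = G.ip (G.br S.ξ X) S.ξ := by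
  rw [S.D_ξ_ip, G.br_self, S.ip_ξ_ξ, map_zero]
  ring

theorem Rm_apply_ξ (X Y : 𝔛) :
    G.Rm X Y S.ξ = S.β ^ 2 • (G.ip X S.ξ • Y - G.ip Y S.ξ • X) := by
  rw [G.Rm_apply]
  simp only [S.nab_ξ, S.nab_β_smul, map_sub, G.nab_smul, G.metric, map_smul, smul_eq_mul,
    AddMonoidHom.sub_apply, RiemannianCalculus.br, G.ip_comm Y X]
  module

theorem ip_Rm_ξ (Y Z W : 𝔛) : G.ip (G.Rm S.ξ Y Z) W
    = S.β ^ 2 * (G.ip Z S.ξ * G.ip Y W - G.ip Y Z * G.ip W S.ξ) := by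
  have h := curvature_pair_symm (r := fun X Y Z W => G.ip (G.Rm X Y Z) W)
    (fun X Y Z W => by simp only [G.Rm_swap X Y, map_neg, LinearMap.neg_apply])
    (fun X Y Z W => G.ip_Rm_swap X Y Z W)
    (fun X Y Z W => by
      rw [← LinearMap.add_apply, ← LinearMap.add_apply, ← map_add, ← map_add, G.bianchi_first,
        map_zero, LinearMap.zero_apply]) S.ξ Y Z W
  rw [h, S.Rm_apply_ξ]
  simp only [map_sub, map_smul, LinearMap.sub_apply, LinearMap.smul_apply, smul_eq_mul]
  rw [G.ip_comm W Y, G.ip_comm Z Y]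
  ring

/-- Sectional curvatures of planes containing `ξ` are `-β²`. -/
theorem Rm_ξ (Y Z : 𝔛) :
    G.Rm S.ξ Y Z = S.β ^ 2 • (G.ip Z S.ξ • Y - G.ip Y Z • S.ξ) := by
  refine sub_eq_zero.1 (G.ip_nondeg _ fun W => ?_)
  simp only [map_sub, map_smul, LinearMap.sub_apply, LinearMap.smul_apply, smul_eq_mul, S.ip_Rm_ξ]
  rw [G.ip_comm W]
  ring

/-- The difference between the curvature and that of a space of constant curvature `-β²`, as a
form in four arguments. -/
def defect (X Y Z W : 𝔛) : C :=
  G.ip (G.Rm X Y Z) W + S.β ^ 2 * (G.ip Y Z * G.ip X W - G.ip X Z * G.ip Y W)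

theorem defect_swap_left (X Y Z W : 𝔛) : S.defect X Y Z W = -S.defect Y X Z W := by
  simp only [defect, G.Rm_swap X Y, map_neg, LinearMap.neg_apply]
  ring

theorem defect_swap_right (X Y Z W : 𝔛) : S.defect X Y Z W = -S.defect X Y W Z := by
  simp only [defect, G.ip_Rm_swap X Y Z W]
  ring

theorem defect_bianchi (X Y Z W : 𝔛) :
    S.defect X Y Z W + S.defect Y Z X W + S.defect Z X Y W = 0 := by
  have h : G.ip (G.Rm X Y Z) W + G.ip (G.Rm Y Z X) W + G.ip (G.Rm Z X Y) W = 0 := by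
    rw [← LinearMap.add_apply, ← LinearMap.add_apply, ← map_add, ← map_add, G.bianchi_first,
        map_zero, LinearMap.zero_apply]
  simp only [defect]
  rw [G.ip_comm Z X, G.ip_comm Y X, G.ip_comm Z Y]
  linear_combination h

theorem defect_pair_symm (X Y Z W : 𝔛) : S.defect X Y Z W = S.defect Z W X Y :=
  curvature_pair_symm S.defect_swap_left S.defect_swap_right S.defect_bianchi X Y Z W

theorem defect_ξ (X Y Z : 𝔛) : S.defect S.ξ X Y Z = 0 := by
  rw [defect, S.Rm_ξ]
  simp only [map_sub, map_smul, LinearMap.sub_apply, LinearMap.smul_apply, smul_eq_mul,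
    G.ip_comm S.ξ]
  ring

/-- The defect commutes with `f`, by the Ricci identity for `f`. -/
theorem defect_f_right (X Y Z W : 𝔛) :
    S.defect X Y (S.f Z) W = -S.defect X Y Z (S.f W) := by
  have h : G.ip Y (S.f X) = -G.ip X (S.f Y) := by rw [G.ip_comm, S.ip_f]
  simp only [defect, G.Rm_apply, S.nab_f, S.nab_ξ, S.nab_β_smul, map_sub, map_add, G.nab_smul,
    G.metric, map_smul, LinearMap.sub_apply, LinearMap.add_apply, LinearMap.smul_apply,
    smul_eq_mul, RiemannianCalculus.br, AddMonoidHom.sub_apply, map_neg, S.ip_f]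
  rw [G.ip_comm Z X, G.ip_comm Z Y, G.ip_comm S.ξ W, h]
  ring

end WeakKenmotsuCalculus

/-! ### Traces in an orthonormal frame -/

/-- An orthonormal frame at the point where the ring homomorphism `ev` evaluates functions:
finitely many fields which are orthonormal to first order there, and in terms of which the value of
every linear form expands. -/
structure RiemannianCalculus.OrthonormalFrame {C 𝔛 : Type*} [CommRing C] [Algebra ℝ C]
    [AddCommGroup 𝔛] [Module C 𝔛] (G : RiemannianCalculus C 𝔛) (ev : C →+* ℝ)
    (ι : Type*) [Fintype ι] where
  E : ι → 𝔛
  expand : ∀ (φ : 𝔛 →ₗ[C] C) X, ev (φ X) = ∑ i, ev (G.ip X (E i)) * ev (φ (E i))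
  ev_ip_self : ∀ i, ev (G.ip (E i) (E i)) = 1
  ev_D_ip : ∀ X i j, ev (G.D X (G.ip (E i) (E j))) = 0

namespace RiemannianCalculus.OrthonormalFrame

variable {C 𝔛 : Type*} [CommRing C] [Algebra ℝ C] [AddCommGroup 𝔛] [Module C 𝔛]
  {G : RiemannianCalculus C 𝔛} {ev : C →+* ℝ} {ι : Type*} [Fintype ι]
  (F : G.OrthonormalFrame ev ι)

/-- A skew-symmetric endomorphism, given by its values `W i` on the frame, acts trivially on the
trace of a bilinear form. -/
theorem sum_add_sum_of_skew (B : 𝔛 →ₗ[C] 𝔛 →ₗ[C] C) (W : ι → 𝔛)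
    (hW : ∀ i j, ev (G.ip (W i) (F.E j)) + ev (G.ip (W j) (F.E i)) = 0) :
    ∑ i, ev (B (W i) (F.E i)) + ∑ i, ev (B (F.E i) (W i)) = 0 := by
  have h1 : ∀ i, ev (B (W i) (F.E i))
      = ∑ j, ev (G.ip (W i) (F.E j)) * ev (B (F.E j) (F.E i)) :=
    fun i => F.expand (B.flip (F.E i)) (W i)
  have h2 : ∀ i, ev (B (F.E i) (W i))
      = ∑ j, ev (G.ip (W i) (F.E j)) * ev (B (F.E i) (F.E j)) :=
    fun i => F.expand (B (F.E i)) (W i)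
  simp only [h1, h2]
  rw [Finset.sum_comm, ← Finset.sum_add_distrib]
  refine Finset.sum_eq_zero fun i _ => ?_
  rw [← Finset.sum_add_distrib]
  refine Finset.sum_eq_zero fun j _ => ?_
  linear_combination ev (B (F.E i) (F.E j)) * hW i j

theorem sum_ip_mul_ip (X Y : 𝔛) :
    ∑ i, ev (G.ip X (F.E i)) * ev (G.ip Y (F.E i)) = ev (G.ip X Y) := by
  rw [G.ip_comm X Y, F.expand (G.ip Y) X]

/-- The trace of a bilinear form may be taken in any family `W` that is orthonormal at the point. -/
theorem sum_eq_sum {κ : Type*} [Fintype κ] {W : κ → 𝔛}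
    (hW : ∀ X Y, ∑ i, ev (G.ip X (W i)) * ev (G.ip Y (W i)) = ev (G.ip X Y))
    (B : 𝔛 →ₗ[C] 𝔛 →ₗ[C] C) :
    ∑ i, ev (B (W i) (W i)) = ∑ j, ev (B (F.E j) (F.E j)) := by
  have h1 : ∀ i, ev (B (W i) (W i)) = ∑ j, ∑ k, ev (G.ip (F.E j) (W i)) * ev (G.ip (F.E k) (W i))
      * ev (B (F.E j) (F.E k)) := fun i => by
    rw [← LinearMap.flip_apply, F.expand]
    refine Finset.sum_congr rfl fun j _ => ?_
    rw [LinearMap.flip_apply, F.expand (B (F.E j)), Finset.mul_sum]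
    refine Finset.sum_congr rfl fun k _ => ?_
    rw [G.ip_comm (W i), G.ip_comm (W i)]
    ring
  have h2 : ∀ j, ev (B (F.E j) (F.E j))
      = ∑ k, ev (G.ip (F.E j) (F.E k)) * ev (B (F.E j) (F.E k)) :=
    fun j => F.expand (B (F.E j)) (F.E j)
  simp only [h1, h2]
  rw [Finset.sum_comm]
  refine Finset.sum_congr rfl fun j _ => ?_
  rw [Finset.sum_comm]
  refine Finset.sum_congr rfl fun k _ => ?_
  rw [← Finset.sum_mul, hW]

end RiemannianCalculus.OrthonormalFrame

namespace WeakKenmotsuCalculus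

variable {C 𝔛 : Type*} [CommRing C] [Algebra ℝ C] [AddCommGroup 𝔛] [Module C 𝔛]
  {G : RiemannianCalculus C 𝔛} (S : WeakKenmotsuCalculus G) {ev : C →+* ℝ} {ι : Type*}
  [Fintype ι] (F : G.OrthonormalFrame ev ι)

theorem nab_Rm_ξ (Y Z W : 𝔛) :
    G.nab Y (G.Rm S.ξ Z W) - G.Rm S.ξ Z (G.nab Y W) - G.Rm S.ξ (G.nab Y Z) W
      = S.β ^ 3 • ((G.ip Y W - G.ip Y S.ξ * G.ip W S.ξ) • Z
        - G.ip Z W • (Y - G.ip Y S.ξ • S.ξ)) := by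
  have hβ : ∀ X, G.D X (S.β ^ 2) = 0 := fun X => by
    rw [Derivation.leibniz_pow, S.D_β, smul_zero, smul_zero]
  simp only [S.Rm_ξ, G.nab_smul, map_sub, hβ, G.metric, S.nab_ξ, map_smul, smul_eq_mul,
    G.ip_comm W Y]
  module

/-- The derivative along `ξ` of the endomorphism-valued two-form `R`, by the second Bianchi identity:
the form arguments are transported by the Lie bracket and `W` by `∇_ξ`. -/
theorem nab_ξ_Rm (Y Z W : 𝔛) :
    G.nab S.ξ (G.Rm Y Z W) = G.Rm Y Z (G.nab S.ξ W) + G.Rm (G.br S.ξ Y) Z W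
      + G.Rm Y (G.br S.ξ Z) W
      + S.β ^ 3 • (((2 * G.ip Y W) - G.ip Y S.ξ * G.ip W S.ξ) • Z
        - ((2 * G.ip Z W) - G.ip Z S.ξ * G.ip W S.ξ) • Y
        + (G.ip Z W * G.ip Y S.ξ - G.ip Y W * G.ip Z S.ξ) • S.ξ) := by
  have h := G.bianchi_second S.ξ Y Z W
  have h1 := S.nab_Rm_ξ Y Z W
  have h2 := S.nab_Rm_ξ Z Y W
  rw [G.Rm_swap Z S.ξ, G.Rm_swap Z S.ξ, G.Rm_swap (G.br Y Z) S.ξ, G.br_swap Z S.ξ, map_neg,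
    map_neg, LinearMap.neg_apply, LinearMap.neg_apply, G.Rm_swap (G.br S.ξ Z) Y] at h
  have h3 : G.Rm S.ξ (G.br Y Z) W = G.Rm S.ξ (G.nab Y Z) W - G.Rm S.ξ (G.nab Z Y) W := by
    simp [RiemannianCalculus.br]
  rw [h3] at h
  linear_combination (norm := module) h + h1 - h2

/-- The trace of `f ∘ R_{Y,Z}` as a function near the point of the frame. -/
def traceForm (Y Z : 𝔛) : C := ∑ i, G.ip (S.f (G.Rm Y Z (F.E i))) (F.E i)

/-- The Lie derivative along `ξ` of the two-form `trace (f ∘ R)`. -/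
theorem ev_D_ξ_traceForm (Y Z : 𝔛) :
    ev (G.D S.ξ (S.traceForm F Y Z)) = ev (S.traceForm F (G.br S.ξ Y) Z)
      + ev (S.traceForm F Y (G.br S.ξ Z)) + 4 * ev (S.β ^ 3) * ev (G.ip Y (S.f Z)) := by
  -- The frame moves by a skew-symmetric matrix, which does not affect the trace.
  have hskew := F.sum_add_sum_of_skew (G.ip ∘ₗ S.f ∘ₗ G.Rm Y Z) (fun i => G.nab S.ξ (F.E i))
    fun i j => by
      rw [G.ip_comm (G.nab S.ξ (F.E j)), ← map_add, ← G.metric, F.ev_D_ip]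
  simp only [LinearMap.comp_apply] at hskew
  have key : ∀ i, ev (G.D S.ξ (G.ip (S.f (G.Rm Y Z (F.E i))) (F.E i)))
      = ev (G.ip (S.f (G.Rm Y Z (G.nab S.ξ (F.E i)))) (F.E i))
        + ev (G.ip (S.f (G.Rm Y Z (F.E i))) (G.nab S.ξ (F.E i)))
        + ev (G.ip (S.f (G.Rm (G.br S.ξ Y) Z (F.E i))) (F.E i))
        + ev (G.ip (S.f (G.Rm Y (G.br S.ξ Z) (F.E i))) (F.E i))
        + ev (S.β ^ 3) * (2 * (ev (G.ip Y (F.E i)) * ev (G.ip (S.f Z) (F.E i)))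
          - ev (G.ip Y S.ξ) * (ev (G.ip (S.ξ) (F.E i)) * ev (G.ip (S.f Z) (F.E i)))
          - 2 * (ev (G.ip Z (F.E i)) * ev (G.ip (S.f Y) (F.E i)))
          + ev (G.ip Z S.ξ) * (ev (G.ip (S.ξ) (F.E i)) * ev (G.ip (S.f Y) (F.E i)))) := by
    intro i
    rw [G.metric, S.nab_ξ_f, S.nab_ξ_Rm, G.ip_comm S.ξ (F.E i)]
    simp only [map_add, map_sub, map_smul, S.f_ξ, LinearMap.add_apply, LinearMap.sub_apply,
      LinearMap.smul_apply, smul_eq_mul, map_mul, map_zero, LinearMap.zero_apply, map_ofNat]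
    ring
  simp only [traceForm, map_sum, key, Finset.sum_add_distrib, ← Finset.mul_sum,
    Finset.sum_sub_distrib, F.sum_ip_mul_ip]
  have h1 : G.ip S.ξ (S.f Z) = 0 := S.ip_ξ_f Z
  have h2 : G.ip S.ξ (S.f Y) = 0 := S.ip_ξ_f Y
  have h3 : G.ip Z (S.f Y) = -G.ip Y (S.f Z) := by rw [G.ip_comm, S.ip_f]
  rw [h1, h2, h3, map_zero, map_neg]
  linear_combination hskew

theorem ev_traceForm_ξ_left (Y : 𝔛) : ev (S.traceForm F S.ξ Y) = 0 := by
  have : ∀ i, ev (G.ip (S.f (G.Rm S.ξ Y (F.E i))) (F.E i))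
      = ev (S.β ^ 2) * (ev (G.ip S.ξ (F.E i)) * ev (G.ip (S.f Y) (F.E i))) := fun i => by
    rw [S.Rm_ξ, G.ip_comm S.ξ (F.E i)]
    simp only [map_sub, map_smul, S.f_ξ, LinearMap.smul_apply, smul_eq_mul, map_mul, smul_zero,
      sub_zero]
  rw [traceForm, map_sum, Finset.sum_congr rfl fun i _ => this i, ← Finset.mul_sum,
    F.sum_ip_mul_ip, S.ip_ξ_f, map_zero, mul_zero]

/-- The Ricci tensor of the metric, in the frame `F`; at the point of the frame it is the trace. -/
def ric (X Y : 𝔛) : C := ∑ i, G.ip (G.Rm (F.E i) X Y) (F.E i)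

/-- The defect as a bilinear form in its outer arguments. -/
def outerDefect (X Y : 𝔛) : 𝔛 →ₗ[C] 𝔛 →ₗ[C] C :=
  LinearMap.mk₂ C (fun Z W => S.defect Z X Y W)
    (fun _ _ _ => by
      simp only [defect, map_add, LinearMap.add_apply]
      ring)
    (fun _ _ _ => by
      simp only [defect, map_smul, LinearMap.smul_apply, smul_eq_mul]
      ring)
    (fun _ _ _ => by
      simp only [defect, map_add]
      ring)
    (fun _ _ _ => by
      simp only [defect, map_smul, smul_eq_mul]
      ring)

/-- The Ricci trace of the defect, as a linear form in its last argument. -/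
def ricDefect (X : 𝔛) : 𝔛 →ₗ[C] C where
  toFun Y := ∑ i, S.defect (F.E i) X Y (F.E i)
  map_add' Y Z := by
    rw [← Finset.sum_add_distrib]
    refine Finset.sum_congr rfl fun i _ => ?_
    simp only [defect, map_add, LinearMap.add_apply]
    ring
  map_smul' c Y := by
    rw [RingHom.id_apply, smul_eq_mul, Finset.mul_sum]
    refine Finset.sum_congr rfl fun i _ => ?_
    simp only [defect, map_smul, LinearMap.smul_apply, smul_eq_mul]
    ring

theorem ricDefect_ξ (X : 𝔛) : S.ricDefect F X S.ξ = 0 :=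
  Finset.sum_eq_zero fun i _ => by rw [S.defect_pair_symm, S.defect_ξ]

theorem defect_f_left (X Y Z W : 𝔛) : S.defect (S.f X) Y Z W = -S.defect X (S.f Y) Z W := by
  rw [S.defect_pair_symm, S.defect_f_right, S.defect_pair_symm, S.defect_swap_left]

/-- The first Bianchi identity turns the trace of `f ∘ R` into a Ricci trace of the defect. -/
theorem ev_traceForm_f (X Y : 𝔛) :
    ev (S.traceForm F X (S.f Y)) = -2 * ev (S.β ^ 2) * ev (G.ip (S.f X) (S.f Y))
      - 2 * ev (S.ricDefect F X (S.f (S.f Y))) := by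
  have hskew := F.sum_add_sum_of_skew (S.outerDefect X (S.f Y)) (fun i => S.f (F.E i))
    fun i j => by rw [G.ip_comm (S.f (F.E j)), S.ip_f, map_neg, neg_add_cancel]
  simp only [outerDefect, LinearMap.mk₂_apply] at hskew
  have hmove : ∀ i, ev (S.defect (F.E i) X (S.f Y) (S.f (F.E i)))
      = -ev (S.defect (F.E i) X (S.f (S.f Y)) (F.E i)) := fun i => by
    rw [← map_neg, S.defect_f_right _ _ (S.f Y), neg_neg]
  simp only [hmove, Finset.sum_neg_distrib] at hskew
  have key : ∀ i, ev (G.ip (S.f (G.Rm X (S.f Y) (F.E i))) (F.E i))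
      = -ev (S.defect (F.E i) X (S.f (S.f Y)) (F.E i))
        - ev (S.defect (S.f (F.E i)) X (S.f Y) (F.E i))
        + ev (S.β ^ 2) * (ev (G.ip X (F.E i)) * ev (G.ip (S.f (S.f Y)) (F.E i))
          - ev (G.ip (S.f X) (F.E i)) * ev (G.ip (S.f Y) (F.E i))) := by
    intro i
    simp only [← map_mul, ← map_sub, ← map_add, ← map_neg]
    congr 1
    have e1 := S.defect_bianchi X (S.f Y) (S.f (F.E i)) (F.E i)
    have e2 := S.defect_f_right X (S.f Y) (F.E i) (F.E i)
    have e3 := S.defect_f_left (S.f Y) (F.E i) X (F.E i)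
    have e4 := S.defect_swap_left (S.f (S.f Y)) (F.E i) X (F.E i)
    have e5 := S.defect_pair_symm (F.E i) (S.f (S.f Y)) X (F.E i)
    have e6 := S.defect_swap_left X (F.E i) (F.E i) (S.f (S.f Y))
    have e7 := S.defect_swap_right (F.E i) X (F.E i) (S.f (S.f Y))
    have e8 : S.defect X (S.f Y) (F.E i) (S.f (F.E i)) =
      G.ip (G.Rm X (S.f Y) (F.E i)) (S.f (F.E i)) + S.β ^ 2 * (G.ip (S.f Y) (F.E i)
        * G.ip X (S.f (F.E i)) - G.ip X (F.E i) * G.ip (S.f Y) (S.f (F.E i))) := rfl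
    rw [S.ip_f, S.ip_f X, S.ip_f (S.f Y)]
    linear_combination e8 - e2 + e1 - e3 + e4 - e5 - e6 + e7
  simp only [traceForm, map_sum, key, ricDefect, LinearMap.coe_mk, AddHom.coe_mk,
    Finset.sum_add_distrib, Finset.sum_sub_distrib, Finset.sum_neg_distrib, ← Finset.mul_sum,
    F.sum_ip_mul_ip]
  have h : G.ip X (S.f (S.f Y)) = -G.ip (S.f X) (S.f Y) := by rw [S.ip_f, neg_neg]
  rw [G.ip_comm, G.ip_comm (S.f (S.f Y)), h, map_neg]
  linear_combination -hskew

theorem ev_ric (X Y : 𝔛) : ev (ric F X Y)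
    = ev (S.ricDefect F X Y) - (Fintype.card ι - 1) * ev (S.β ^ 2) * ev (G.ip X Y) := by
  have key : ∀ i, ev (G.ip (G.Rm (F.E i) X Y) (F.E i)) = ev (S.defect (F.E i) X Y (F.E i))
      + ev (S.β ^ 2) * (ev (G.ip X (F.E i)) * ev (G.ip Y (F.E i)))
      - ev (S.β ^ 2) * ev (G.ip X Y) := fun i => by
    rw [defect, G.ip_comm (F.E i) Y]
    simp only [map_add, map_sub, map_mul, F.ev_ip_self]
    ring
  simp only [ric, map_sum, key, ricDefect, LinearMap.coe_mk, AddHom.coe_mk,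
    Finset.sum_add_distrib, Finset.sum_sub_distrib, ← Finset.mul_sum, F.sum_ip_mul_ip,
    Finset.sum_const, Finset.card_univ, nsmul_eq_mul]
  ring

end WeakKenmotsuCalculus

/-! ### The soliton equation -/

namespace WeakKenmotsuCalculus

variable {C 𝔛 : Type*} [CommRing C] [Algebra ℝ C] [AddCommGroup 𝔛] [Module C 𝔛]
  {G : RiemannianCalculus C 𝔛} (S : WeakKenmotsuCalculus G)

/-- The `∗`-`η`-Ricci soliton equation for a contact field `V`, with `T` in the place of
`2 Ric^∗`. The last two fields are the properties of the `∗`-Ricci tensor of a weak Kenmotsu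
structure on which the rigidity rests. -/
structure ContactSoliton (V : 𝔛) (T : 𝔛 → 𝔛 → C) (lam mu σ : C) : Prop where
  D_lam : ∀ X, G.D X lam = 0
  D_mu : ∀ X, G.D X mu = 0
  soliton : ∀ X Y, G.D V (G.ip X Y) - G.ip (G.br V X) Y - G.ip X (G.br V Y) + T X Y
    = 2 * lam * G.ip X Y + 2 * mu * (G.ip X S.ξ * G.ip Y S.ξ)
  contact : ∀ Y, G.D V (G.ip Y S.ξ) - G.ip (G.br V Y) S.ξ = σ * G.ip Y S.ξ
  T_ξ : ∀ Y, T S.ξ Y = 0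
  D_ξ_T : ∀ X Y, G.D S.ξ (T X Y) = T (G.br S.ξ X) Y + T X (G.br S.ξ Y)
    + 4 * S.β ^ 3 * G.ip X (S.f (S.f Y))

namespace ContactSoliton

variable {S} {V : 𝔛} {T : 𝔛 → 𝔛 → C} {lam mu σ : C}

theorem two_mul_factor (h : S.ContactSoliton V T lam mu σ) : 2 * σ = 2 * (lam + mu) := by
  have h1 := h.soliton S.ξ S.ξ
  have h2 := h.contact S.ξ
  rw [S.ip_ξ_ξ, Derivation.map_one_eq_zero] at h1 h2
  rw [h.T_ξ, G.ip_comm S.ξ] at h1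
  linear_combination h1 - 2 * h2

theorem factor_eq (h : S.ContactSoliton V T lam mu σ) : σ = lam + mu := by
  have h1 : (2 : ℝ) • (σ - (lam + mu)) = 0 := by
    rw [Algebra.smul_def, map_ofNat]
    linear_combination h.two_mul_factor
  exact sub_eq_zero.1 ((smul_eq_zero.1 h1).resolve_left two_ne_zero)

theorem D_factor (h : S.ContactSoliton V T lam mu σ) (X : 𝔛) : G.D X σ = 0 := by
  rw [h.factor_eq, map_add, h.D_lam, h.D_mu, add_zero]

theorem br_ξ (h : S.ContactSoliton V T lam mu σ) : G.br S.ξ V = σ • S.ξ := by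
  refine sub_eq_zero.1 (G.ip_nondeg _ fun Y => ?_)
  have h1 := h.soliton S.ξ Y
  have h2 := h.contact Y
  rw [h.T_ξ, G.ip_comm S.ξ Y, G.ip_comm S.ξ (G.br V Y), S.ip_ξ_ξ] at h1
  rw [G.br_swap]
  simp only [map_sub, map_neg, map_smul, LinearMap.sub_apply, LinearMap.neg_apply,
    LinearMap.smul_apply, smul_eq_mul]
  rw [G.ip_comm S.ξ Y]
  linear_combination h1 - h2 - G.ip Y S.ξ * h.two_mul_factor

theorem br_ξ_br (h : S.ContactSoliton V T lam mu σ) (X : 𝔛) :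
    G.br S.ξ (G.br V X) = σ • G.br S.ξ X + G.br V (G.br S.ξ X) := by
  rw [G.br_jacobi, h.br_ξ, G.br_smul_left, h.D_factor, zero_smul, sub_zero]

/-- The Lie derivative along `ξ` of the soliton equation. -/
theorem algebraic_T (h : S.ContactSoliton V T lam mu σ) (X Y : 𝔛) :
    4 * S.β ^ 3 * G.ip X (S.f (S.f Y)) = 2 * S.β * T X Y
      - 2 * σ * S.β * (G.ip X Y - G.ip X S.ξ * G.ip Y S.ξ) := by
  have hT : T X Y = 2 * lam * G.ip X Y + 2 * mu * (G.ip X S.ξ * G.ip Y S.ξ)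
      - (G.D V (G.ip X Y) - G.ip (G.br V X) Y - G.ip X (G.br V Y)) := by
    linear_combination h.soliton X Y
  have h0 := h.D_ξ_T X Y
  rw [hT] at h0
  have hV : G.D S.ξ (G.D V (G.ip X Y)) = σ * G.D S.ξ (G.ip X Y) + G.D V (G.D S.ξ (G.ip X Y)) := by
    have := G.D_br S.ξ V (G.ip X Y)
    rw [h.br_ξ, map_smul, Derivation.smul_apply, smul_eq_mul] at this
    linear_combination -this
  have h2 : ∀ Z, G.D Z (2 : C) = 0 := fun Z => by
    simpa using (G.D Z).map_natCast 2
  simp only [map_add, map_sub, Derivation.leibniz, smul_eq_mul, hV, h.D_lam, h.D_mu, h2,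
    S.D_ξ_ip_ξ, S.D_ξ_ip, h.br_ξ_br, S.D_β, map_smul, LinearMap.add_apply, LinearMap.smul_apply]
    at h0
  linear_combination -h0 - h.soliton (G.br S.ξ X) Y - h.soliton X (G.br S.ξ Y)
    - 2 * S.β * h.soliton X Y + 2 * S.β * G.ip X S.ξ * h.contact Y
    + 2 * S.β * G.ip Y S.ξ * h.contact X
    + 2 * S.β * G.ip X S.ξ * G.ip Y S.ξ * h.two_mul_factor

/-- The Lie derivative along `ξ` of `algebraic_T`: both the left-hand side and the term with `T`
contribute `8 β⁴ g(X, f² Y)`, so that only the term with `σ` is left. -/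
theorem factor_mul (h : S.ContactSoliton V T lam mu σ) (X Y : 𝔛) :
    4 * S.β ^ 2 * σ * (G.ip X Y - G.ip X S.ξ * G.ip Y S.ξ) = 0 := by
  have h0 := congrArg (G.D S.ξ) (h.algebraic_T X Y)
  have h2 : ∀ Z, G.D Z (2 : C) = 0 := fun Z => by
    simpa using (G.D Z).map_natCast 2
  have h4 : ∀ Z, G.D Z (4 : C) = 0 := fun Z => by
    simpa using (G.D Z).map_natCast 4
  have hX := h.algebraic_T (G.br S.ξ X) Y
  have hY := h.algebraic_T X (G.br S.ξ Y)
  simp only [map_sub, Derivation.leibniz, Derivation.leibniz_pow, smul_eq_mul, h.D_factor, h2, h4,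
    S.D_ξ_ip_ξ, S.D_ξ_ip, h.D_ξ_T, S.D_β, S.ip_f_ξ, S.br_ξ_f] at h0
  linear_combination h0 - hX - hY

end ContactSoliton

end WeakKenmotsuCalculus

namespace RiemGeom

open Topology

/-! ### Smooth fields on a manifold -/

section Fields

variable {E : Type*} [NormedAddCommGroup E] [NormedSpace ℝ E] [FiniteDimensional ℝ E]
  {H : Type*} [TopologicalSpace H] (I : ModelWithCorners ℝ E H)
  {M : Type*} [TopologicalSpace M] [ChartedSpace H M] [IsManifold I ∞ M]

variable (M) in
/-- The ring of smooth functions. -/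
abbrev SmoothFun := C^∞⟮I, M; 𝓘(ℝ, ℝ), ℝ⟯

variable (M) in
/-- The smooth vector fields. -/
abbrev SmoothField := Cₛ^∞⟮I; E, fun x : M => TangentSpace I x⟯

instance : SMul (SmoothFun I M) (SmoothField I M) :=
  ⟨fun c X => ⟨fun x => c x • X x, c.contMDiff.smul_section X.contMDiff⟩⟩

variable {I}

theorem SmoothField.mdiff (X : SmoothField I M) (x : M) : MDiffAt (T% (fun y => X y)) x :=
  X.contMDiff.contMDiffAt.mdifferentiableAt (by simp)

theorem SmoothFun.mdiff (c : SmoothFun I M) (x : M) : MDiffAt (fun y => c y) x :=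
  c.contMDiff.contMDiffAt.mdifferentiableAt (by simp)

instance : Module (SmoothFun I M) (SmoothField I M) where
  one_smul X := by ext x; exact one_smul ℝ (X x)
  mul_smul a b X := by ext x; exact mul_smul (a x) (b x) (X x)
  smul_zero a := by ext x; exact smul_zero (a x)
  smul_add a X Y := by ext x; exact smul_add (a x) (X x) (Y x)
  add_smul a b X := by ext x; exact add_smul (a x) (b x) (X x)
  zero_smul X := by ext x; exact zero_smul ℝ (X x)

theorem contMDiff_mvfderiv (c : SmoothFun I M) (X : SmoothField I M) :
    CMDiff ∞ (fun x => mvfderiv I c x (X x)) := by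
  have h := (c.contMDiff.contMDiff_tangentMap (m := ∞) (by simp)).comp X.contMDiff
  exact (contMDiff_snd_tangentBundle_modelSpace ℝ 𝓘(ℝ, ℝ)).comp h

theorem contMDiff_mlieBracket (X Y : SmoothField I M) :
    CMDiff ∞ (T% (mlieBracket I X Y)) := by
  have : IsManifold I (minSmoothness ℝ 2) M := by
    rw [minSmoothness_of_isRCLikeNormedField]
    exact .of_le (n := ∞) (WithTop.coe_le_coe.2 le_top)
  have : IsManifold I (((⊤ : ℕ∞) : WithTop ℕ∞) + 1) M := inferInstanceAs (IsManifold I ∞ M)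
  exact ContDiff.mlieBracket_vectorField (m := ⊤) (n := ⊤) X.contMDiff Y.contMDiff (by simp)

/-- A field which is smooth near a point has the germ of a globally smooth field. -/
theorem exists_field_eventuallyEq [T2Space M] {x : M} {U : Set M} (hU : IsOpen U) (hx : x ∈ U)
    {Z : Π y : M, TangentSpace I y} (hZ : CMDiff[U] ∞ (T% Z)) :
    ∃ X : SmoothField I M, ∀ᶠ y in 𝓝 x, X y = Z y := by
  obtain ⟨χ, -, hχ⟩ := ((SmoothBumpFunction.nhds_basis_tsupport (I := I) x).mem_iff).1
    (hU.mem_nhds hx)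
  refine ⟨⟨(χ : M → ℝ) • Z,
    (χ.contMDiff.contMDiffOn (s := U)).smul_section_of_tsupport hU hχ hZ⟩, ?_⟩
  filter_upwards [χ.eventuallyEq_one] with y hy
  change χ y • Z y = Z y
  rw [hy, Pi.one_apply, one_smul]

theorem exists_field_eventuallyEq_extend [T2Space M] {x : M} (u : TangentSpace I x) :
    ∃ X : SmoothField I M, ∀ᶠ y in 𝓝 x, X y = FiberBundle.extend E u y := by
  obtain ⟨s, hs, h⟩ := FiberBundle.exists_contMDiffOn_extend (k := ∞) I E u
  obtain ⟨U, hUs, hU, hx⟩ := mem_nhds_iff.1 hs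
  exact exists_field_eventuallyEq hU hx (h.mono hUs)

theorem exists_field_apply_eq [T2Space M] {x : M} (u : TangentSpace I x) :
    ∃ X : SmoothField I M, X x = u := by
  obtain ⟨X, hX⟩ := exists_field_eventuallyEq_extend u
  exact ⟨X, by rw [hX.self_of_nhds, FiberBundle.extend_apply_self]⟩

end Fields

section Frame

variable {E : Type*} [NormedAddCommGroup E] [NormedSpace ℝ E] [FiniteDimensional ℝ E]
  {H : Type*} [TopologicalSpace H] {I : ModelWithCorners ℝ E H}
  {M : Type*} [TopologicalSpace M] [ChartedSpace H M] [IsManifold I ∞ M]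
  [RiemannianBundle (fun x : M => TangentSpace I x)]
  [IsContMDiffRiemannianBundle I ∞ E (fun x : M => TangentSpace I x)]

open InnerProductSpace in
/-- The Gram-Schmidt process preserves smoothness of linearly independent fields. -/
theorem contMDiffAt_gramSchmidt {m : ℕ} {e : Fin m → Π y : M, TangentSpace I y} {x : M}
    (he : ∀ i, CMDiffAt ∞ (T% (e i)) x) (hx : LinearIndependent ℝ (fun i => e i x)) (i : Fin m) :
    CMDiffAt ∞ (T% (fun y => gramSchmidt ℝ (fun j => e j y) i)) x := by
  induction i using WellFoundedLT.induction with
  | ind i ih =>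
    have h : ∀ y, gramSchmidt ℝ (fun j => e j y) i = (e i - fun y => ∑ j ∈ Finset.Iio i,
        (inner ℝ (gramSchmidt ℝ (fun j => e j y) j) (e i y)
          / inner ℝ (gramSchmidt ℝ (fun j => e j y) j) (gramSchmidt ℝ (fun j => e j y) j))
          • gramSchmidt ℝ (fun j => e j y) j) y := by
      intro y
      rw [Pi.sub_apply, eq_sub_iff_add_eq]
      conv_rhs => rw [gramSchmidt_def'' ℝ (fun j => e j y) i]
      simp only [real_inner_self_eq_norm_sq, RCLike.ofReal_real_eq_id, id]
    simp only [h]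
    refine (he i).sub_section (.sum_section fun j hj => ?_)
    have hj' := ih j (Finset.mem_Iio.1 hj)
    have h1 : CMDiffAt ∞ (fun y => inner ℝ (gramSchmidt ℝ (fun j => e j y) j) (e i y)) x :=
      ContMDiffAt.inner_bundle hj' (he i)
    have h2 : CMDiffAt ∞ (fun y => inner ℝ (gramSchmidt ℝ (fun j => e j y) j)
      (gramSchmidt ℝ (fun j => e j y) j)) x := ContMDiffAt.inner_bundle hj' hj'
    refine (h1.div₀ h2 ?_).smul_section hj'
    exact inner_self_ne_zero.2 (gramSchmidt_ne_zero j hx)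

open InnerProductSpace in
theorem contMDiffAt_gramSchmidtNormed {m : ℕ} {e : Fin m → Π y : M, TangentSpace I y} {x : M}
    (he : ∀ i, CMDiffAt ∞ (T% (e i)) x) (hx : LinearIndependent ℝ (fun i => e i x)) (i : Fin m) :
    CMDiffAt ∞ (T% (fun y => gramSchmidtNormed ℝ (fun j => e j y) i)) x := by
  have h := contMDiffAt_gramSchmidt he hx i
  have h0 : inner ℝ (gramSchmidt ℝ (fun j => e j x) i) (gramSchmidt ℝ (fun j => e j x) i) ≠ 0 :=
    inner_self_ne_zero.2 (gramSchmidt_ne_zero i hx)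
  have hin : CMDiffAt ∞ (fun y => inner ℝ (gramSchmidt ℝ (fun j => e j y) i)
      (gramSchmidt ℝ (fun j => e j y) i)) x := ContMDiffAt.inner_bundle h h
  have h1 : CMDiffAt ∞ (fun y => (√(inner ℝ (gramSchmidt ℝ (fun j => e j y) i)
      (gramSchmidt ℝ (fun j => e j y) i)))⁻¹) x := by
    refine ContMDiffAt.inv₀ ?_ ?_
    · exact (Real.contDiffAt_sqrt h0).contMDiffAt.comp x hin
    · exact (Real.sqrt_ne_zero').2 (lt_of_le_of_ne real_inner_self_nonneg h0.symm)
  have h2 := h1.smul_section h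
  simp only [gramSchmidtNormed, norm_eq_sqrt_real_inner]
  exact h2

/-- Near every point there are globally smooth fields which are orthonormal, and which at the point
are the standard orthonormal basis of the tangent space. -/
theorem exists_orthonormal_fields [T2Space M] (x : M) :
    ∃ e : Fin (Module.finrank ℝ (TangentSpace I x)) → SmoothField I M,
      (∀ i, e i x = stdOrthonormalBasis ℝ (TangentSpace I x) i) ∧
      ∀ᶠ y in 𝓝 x, Orthonormal ℝ (fun i => e i y) := by
  set t := trivializationAt E (fun x : M => TangentSpace I x) x
  have hx : x ∈ t.baseSet := FiberBundle.mem_baseSet_trivializationAt' x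
  let b := stdOrthonormalBasis ℝ (TangentSpace I x)
  let v : Fin (Module.finrank ℝ (TangentSpace I x)) → Π y : M, TangentSpace I y :=
    fun i => FiberBundle.extend E (b i)
  have hv : ∀ i, CMDiff[t.baseSet] ∞ (T% (v i)) := fun i => by
    rw [t.contMDiffOn_section_baseSet_iff]
    exact (contMDiffOn_const (c := (t ⟨x, b i⟩).2)).congr fun y hy => by
      have h := congrArg Prod.snd (t.apply_mk_symm hy (t ⟨x, b i⟩).2)
      exact h
  have hli : ∀ y ∈ t.baseSet, LinearIndependent ℝ (fun i => v i y) := fun y hy => by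
    have h := b.toBasis.linearIndependent.map'
      ((t.linearEquivAt ℝ x hx).trans (t.linearEquivAt ℝ y hy).symm).toLinearMap
      (LinearEquiv.ker _)
    rw [OrthonormalBasis.coe_toBasis] at h
    exact h
  have hsm : ∀ i, CMDiff[t.baseSet] ∞
      (T% (fun y => InnerProductSpace.gramSchmidtNormed ℝ (fun j => v j y) i)) :=
    fun i y hy => (contMDiffAt_gramSchmidtNormed (fun j => (hv j).contMDiffAt
      (t.open_baseSet.mem_nhds hy)) (hli y hy) i).contMDiffWithinAt
  choose e he using fun i => exists_field_eventuallyEq t.open_baseSet hx (hsm i)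
  refine ⟨e, fun i => ?_, ?_⟩
  · rw [(he i).self_of_nhds]
    have : (fun j => v j x) = b := funext fun j => FiberBundle.extend_apply_self E (b j)
    rw [this, InnerProductSpace.gramSchmidtNormed,
      InnerProductSpace.gramSchmidt_of_orthogonal ℝ (f := b) (fun i j hij => b.orthonormal.2 hij),
      b.orthonormal.1 i]
    simp [b]
  · filter_upwards [Filter.eventually_all.2 he, t.open_baseSet.mem_nhds hx] with y hy hyt
    simp only [hy]
    exact InnerProductSpace.gramSchmidtNormed_orthonormal (hli y hyt)

end Frame

section Calculus

variable {E : Type*} [NormedAddCommGroup E] [NormedSpace ℝ E] [FiniteDimensional ℝ E]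
  {H : Type*} [TopologicalSpace H] {I : ModelWithCorners ℝ E H}
  {M : Type*} [TopologicalSpace M] [ChartedSpace H M] [IsManifold I ∞ M]
  [RiemannianBundle (fun x : M => TangentSpace I x)]
  [IsContMDiffRiemannianBundle I ∞ E (fun x : M => TangentSpace I x)]

/-! ### The Riemannian calculus of smooth fields -/

theorem contMDiff_inner (X Y : SmoothField I M) : CMDiff ∞ (fun y => inner ℝ (X y) (Y y)) :=
  ContMDiff.inner_bundle X.contMDiff Y.contMDiff

/-- The pointwise inner product of two fields. -/
def innerFun (X Y : SmoothField I M) : SmoothFun I M := ⟨_, contMDiff_inner X Y⟩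

theorem contMDiff_koszul (X Y Z : SmoothField I M) : CMDiff ∞ (koszul I Y X Z) := by
  have h1 := contMDiff_mvfderiv (innerFun Y Z) X
  have h2 := contMDiff_mvfderiv (innerFun X Z) Y
  have h3 := contMDiff_mvfderiv (innerFun X Y) Z
  have h4 : CMDiff ∞ (fun y => inner ℝ (mlieBracket I X Y y) (Z y)) :=
    ContMDiff.inner_bundle (contMDiff_mlieBracket X Y) Z.contMDiff
  have h5 : CMDiff ∞ (fun y => inner ℝ (mlieBracket I X Z y) (Y y)) :=
    ContMDiff.inner_bundle (contMDiff_mlieBracket X Z) Y.contMDiff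
  have h6 : CMDiff ∞ (fun y => inner ℝ (mlieBracket I Y Z y) (X y)) :=
    ContMDiff.inner_bundle (contMDiff_mlieBracket Y Z) X.contMDiff
  exact ((((h1.add h2).sub h3).add h4).sub h5).sub h6

theorem Orthonormal.sum_inner_smul {V ι : Type*} [NormedAddCommGroup V] [InnerProductSpace ℝ V]
    [FiniteDimensional ℝ V] [Fintype ι] {e : ι → V} (he : Orthonormal ℝ e)
    (hc : Fintype.card ι = Module.finrank ℝ V) (v : V) : ∑ i, inner ℝ v (e i) • e i = v := by
  have hs : ⊤ ≤ Submodule.span ℝ (Set.range e) :=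
    (he.linearIndependent.span_eq_top_of_card_eq_finrank' hc).ge
  have h := (OrthonormalBasis.mk he hs).sum_repr' v
  rw [OrthonormalBasis.coe_mk] at h
  simpa only [real_inner_comm v] using h

theorem finrank_tangentSpace_eq (x y : M) :
    Module.finrank ℝ (TangentSpace I x) = Module.finrank ℝ (TangentSpace I y) := rfl

theorem contMDiff_nabla [T2Space M] (X Y : SmoothField I M) : CMDiff ∞ (T% (nabla I X Y)) := by
  intro x
  obtain ⟨e, -, he⟩ := exists_orthonormal_fields (I := I) x
  have h : CMDiffAt ∞ (T% (fun y => ∑ i, ((2 : ℝ)⁻¹ * koszul I Y X (e i) y) • e i y)) x :=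
    .sum_section fun i _ => .smul_section (contMDiffAt_const.mul (contMDiff_koszul X Y (e i) x))
      (e i).contMDiff.contMDiffAt
  refine h.congr_of_eventuallyEq ?_
  filter_upwards [he] with y hy
  have := Orthonormal.sum_inner_smul hy
    (by rw [Fintype.card_fin, finrank_tangentSpace_eq x y]) (nabla I X Y y)
  rw [← this]
  simp only [nabla, inner_leviCivita (Y.mdiff y) (X.mdiff y) ((e _).mdiff y)]

/-- The field `∇_X Y`. -/
def nablaField [T2Space M] (X Y : SmoothField I M) : SmoothField I M := ⟨_, contMDiff_nabla X Y⟩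

theorem nablaField_apply [T2Space M] (X Y : SmoothField I M) (x : M) :
    nablaField X Y x = leviCivita I M Y x (X x) := rfl

/-- The Lie bracket of fields. -/
def bracketField (X Y : SmoothField I M) : SmoothField I M := ⟨_, contMDiff_mlieBracket X Y⟩

theorem nablaField_sub_nablaField [T2Space M] (X Y : SmoothField I M) :
    nablaField X Y - nablaField Y X = bracketField X Y := by
  ext x
  exact leviCivita_torsionFree (X.mdiff x) (Y.mdiff x)

theorem bracketField_jacobi (X Y Z : SmoothField I M) :
    bracketField X (bracketField Y Z)
      = bracketField (bracketField X Y) Z + bracketField Y (bracketField X Z) := by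
  have : IsManifold I (minSmoothness ℝ 3) M := by
    rw [minSmoothness_of_isRCLikeNormedField]
    exact .of_le (n := ∞) (WithTop.coe_le_coe.2 le_top)
  have h2 : minSmoothness ℝ 2 ≤ ∞ := by
    rw [minSmoothness_of_isRCLikeNormedField]
    exact WithTop.coe_le_coe.2 le_top
  ext x
  exact congrFun (leibniz_identity_mlieBracket (X.contMDiff.of_le h2) (Y.contMDiff.of_le h2)
    (Z.contMDiff.of_le h2)) x

/-- The derivative of a function along a field. -/
def derivFun (X : SmoothField I M) (c : SmoothFun I M) : SmoothFun I M :=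
  ⟨_, contMDiff_mvfderiv c X⟩

theorem bracketField_smul_right (X Y : SmoothField I M) (c : SmoothFun I M) :
    bracketField X (c • Y) = derivFun X c • Y + c • bracketField X Y := by
  ext x
  exact mlieBracket_smul_right (c.mdiff x) (Y.mdiff x)

theorem bracketField_add_right (X Y Z : SmoothField I M) :
    bracketField X (Y + Z) = bracketField X Y + bracketField X Z := by
  ext x
  exact mlieBracket_add_right (Y.mdiff x) (Z.mdiff x)

/-- Functions are differentiated along a bracket by the commutator: this follows from the Jacobi
identity for `X`, `Y` and a multiple `c Z` by the Leibniz rule. -/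
theorem derivFun_bracketField [T2Space M] (X Y : SmoothField I M) (c : SmoothFun I M) :
    derivFun (bracketField X Y) c = derivFun X (derivFun Y c) - derivFun Y (derivFun X c) := by
  have key : ∀ Z : SmoothField I M,
      (derivFun (bracketField X Y) c - (derivFun X (derivFun Y c) - derivFun Y (derivFun X c))) • Z
        = 0 := fun Z => by
    have h := bracketField_jacobi X Y (c • Z)
    simp only [bracketField_smul_right, bracketField_add_right] at h
    rw [bracketField_jacobi X Y Z] at h
    rw [← sub_eq_zero] at h
    rw [← neg_eq_zero, ← h]
    module
  ext x
  by_cases hx : ∃ z : TangentSpace I x, z ≠ 0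
  · obtain ⟨z, hz⟩ := hx
    obtain ⟨Z, rfl⟩ := exists_field_apply_eq z
    have h := congrArg (fun W : SmoothField I M => W x) (key Z)
    exact sub_eq_zero.1 ((smul_eq_zero.1 h).resolve_right hz)
  · push Not at hx
    change mvfderiv I c x (bracketField X Y x) = mvfderiv I (derivFun Y c) x (X x)
      - mvfderiv I (derivFun X c) x (Y x)
    rw [hx (bracketField X Y x), hx (X x), hx (Y x)]
    simp only [map_zero, sub_zero]

/-- The rules of Riemannian calculus for smooth functions and fields on a manifold. -/
def calculus [T2Space M] : RiemannianCalculus (SmoothFun I M) (SmoothField I M) where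
  D :=
    { toFun := fun X => Derivation.mk'
        { toFun := derivFun X
          map_add' := fun a b => by
            ext x
            exact congrArg (· (X x)) (mvfderiv_fun_add (a.mdiff x) (b.mdiff x))
          map_smul' := fun r c => by
            ext x
            have h := mvfderiv_fun_mul (mdifferentiableAt_const (c := r)) (c.mdiff x)
            rw [mvfderiv_const, smul_zero, add_zero] at h
            exact congrArg (· (X x)) h }
        (fun a b => by
          ext x
          exact congrArg (· (X x)) (mvfderiv_fun_mul (a.mdiff x) (b.mdiff x)))
      map_add' := fun X Y => by
        ext c x
        exact map_add (mvfderiv I c x) (X x) (Y x)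
      map_smul' := fun a X => by
        ext c x
        exact map_smul (mvfderiv I c x) (a x) (X x) }
  nab :=
    { toFun := fun X =>
        { toFun := nablaField X
          map_zero' := by
            ext x
            exact congrArg (· (X x)) ((leviCivita I M).isCovariantDerivativeOnUniv.zero)
          map_add' := fun Y Z => by
            ext x
            exact congrArg (· (X x))
              ((leviCivita I M).isCovariantDerivativeOnUniv.add (Y.mdiff x) (Z.mdiff x)) }
      map_add' := fun X Y => by
        ext Z x
        exact map_add (leviCivita I M Z x) (X x) (Y x)
      map_smul' := fun a X => by
        ext Z x
        exact map_smul (leviCivita I M Z x) (a x) (X x) }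
  ip := LinearMap.mk₂ _ innerFun
    (fun X Y Z => by ext x; exact inner_add_left (X x) (Y x) (Z x))
    (fun a X Y => by ext x; exact real_inner_smul_left (X x) (Y x) (a x))
    (fun X Y Z => by ext x; exact inner_add_right (X x) (Y x) (Z x))
    (fun a X Y => by ext x; exact real_inner_smul_right (X x) (Y x) (a x))
  ip_comm X Y := by ext x; exact real_inner_comm (Y x) (X x)
  ip_nondeg X h := by
    ext x
    have h1 : inner ℝ (X x) (X x) = 0 := congrArg (fun c : SmoothFun I M => c x) (h X)
    exact inner_self_eq_zero.1 h1
  nab_smul X c Y := by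
    ext x
    exact congrArg (· (X x))
      ((leviCivita I M).isCovariantDerivativeOnUniv.leibniz (Y.mdiff x) (c.mdiff x))
  metric X Y Z := by
    ext x
    exact leviCivita_metric (X.mdiff x) (Y.mdiff x) (Z.mdiff x)
  D_torsion X Y c := (congrArg (derivFun · c) (nablaField_sub_nablaField X Y)).trans
    (derivFun_bracketField X Y c)
  jacobi X Y Z := by
    have h := bracketField_jacobi X Y Z
    simp only [← nablaField_sub_nablaField] at h
    exact h

end Calculus

section Pointwise

variable {E : Type*} [NormedAddCommGroup E] [NormedSpace ℝ E] [FiniteDimensional ℝ E]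
  {H : Type*} [TopologicalSpace H] {I : ModelWithCorners ℝ E H}
  {M : Type*} [TopologicalSpace M] [T2Space M] [ChartedSpace H M] [IsManifold I ∞ M]
  [RiemannianBundle (fun x : M => TangentSpace I x)]
  [IsContMDiffRiemannianBundle I ∞ E (fun x : M => TangentSpace I x)]

/-! ### Values at a point -/

/-- The evaluation of smooth functions at a point. -/
abbrev evalAt (x : M) : SmoothFun I M →+* ℝ := ContMDiffMap.evalRingHom x

theorem calculus_br (X Y : SmoothField I M) : calculus.br X Y = bracketField X Y :=
  nablaField_sub_nablaField X Y

theorem SmoothField.sum_apply {ι : Type*} (s : Finset ι) (X : ι → SmoothField I M) (x : M) :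
    (∑ i ∈ s, X i) x = ∑ i ∈ s, X i x := by
  have h := congrFun (map_sum (ContMDiffSection.coeAddHom I E ∞ (fun x : M => TangentSpace I x))
    X s) x
  rwa [Finset.sum_apply] at h

theorem derivFun_congr {a b : SmoothFun I M} {x : M} (h : ∀ᶠ y in 𝓝 x, a y = b y)
    (X : SmoothField I M) : derivFun X a x = derivFun X b x := by
  have h1 : mfderiv I 𝓘(ℝ, ℝ) a x = mfderiv I 𝓘(ℝ, ℝ) b x := Filter.EventuallyEq.mfderiv_eq h
  exact congrArg (fun L : TangentSpace I x →L[ℝ] ℝ => L (X x)) h1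

variable (I) in
/-- Near every point the metric has an orthonormal frame. -/
def frameAt (x : M) : (calculus (I := I) (M := M)).OrthonormalFrame (evalAt x)
    (Fin (Module.finrank ℝ (TangentSpace I x))) where
  E := (exists_orthonormal_fields x).choose
  expand φ X := by
    set e := (exists_orthonormal_fields (I := I) x).choose
    obtain ⟨U, hUe, hU, hx⟩ := mem_nhds_iff.1 (exists_orthonormal_fields (I := I) x).choose_spec.2
    obtain ⟨χ, -, hχ⟩ := ((SmoothBumpFunction.nhds_basis_tsupport (I := I) x).mem_iff).1
      (hU.mem_nhds hx)
    -- The expansion of `X` in the frame holds near `x` only; a bump function makes it global.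
    let c : SmoothFun I M := ⟨χ, χ.contMDiff⟩
    have hc : evalAt x c = 1 := χ.eq_one
    have h : c • X = ∑ i, (c * calculus.ip X (e i)) • e i := by
      ext y
      rw [SmoothField.sum_apply]
      change χ y • X y = ∑ i, (χ y * inner ℝ (X y) (e i y)) • e i y
      by_cases hy : y ∈ U
      · simp only [mul_smul, ← Finset.smul_sum]
        rw [Orthonormal.sum_inner_smul (hUe hy)
          (by rw [Fintype.card_fin, finrank_tangentSpace_eq x y])]
      · rw [image_eq_zero_of_notMem_tsupport fun h => hy (hχ h)]
        simp
    have h2 := congrArg (fun Z => evalAt x (φ Z)) h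
    simp only [map_smul, map_sum, smul_eq_mul, map_mul, hc, one_mul] at h2
    exact h2
  ev_ip_self i := by
    have h := (exists_orthonormal_fields (I := I) x).choose_spec.2.self_of_nhds.1 i
    exact (real_inner_self_eq_norm_sq _).trans (by rw [h, one_pow])
  ev_D_ip X i j := by
    have h := (exists_orthonormal_fields (I := I) x).choose_spec.2
    set e := (exists_orthonormal_fields (I := I) x).choose
    let c : SmoothFun I M := algebraMap ℝ _ (if i = j then 1 else 0)
    have h1 : ∀ᶠ y in 𝓝 x, calculus.ip (e i) (e j) y = c y := by
      filter_upwards [h] with y hy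
      exact (orthonormal_iff_ite.1 hy) i j
    exact (derivFun_congr h1 X).trans
      (congrArg (evalAt x) ((calculus.D X).map_algebraMap (if i = j then (1 : ℝ) else 0)))

theorem frameAt_apply (x : M) (i : Fin (Module.finrank ℝ (TangentSpace I x))) :
    (frameAt I x).E i x = stdOrthonormalBasis ℝ (TangentSpace I x) i :=
  (exists_orthonormal_fields x).choose_spec.1 i

theorem frameAt_orthonormal (x : M) :
    ∀ᶠ y in 𝓝 x, Orthonormal ℝ (fun i => (frameAt I x).E i y) :=
  (exists_orthonormal_fields x).choose_spec.2

/-- Linear forms over the smooth functions act pointwise. -/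
theorem evalAt_congr (φ : SmoothField I M →ₗ[SmoothFun I M] SmoothFun I M)
    {X Y : SmoothField I M} {x : M} (h : X x = Y x) : evalAt x (φ X) = evalAt x (φ Y) := by
  rw [(frameAt I x).expand φ X, (frameAt I x).expand φ Y]
  refine Finset.sum_congr rfl fun i _ => ?_
  have h1 : evalAt x (calculus.ip X ((frameAt I x).E i))
      = evalAt x (calculus.ip Y ((frameAt I x).E i)) :=
    congrArg (fun v => inner ℝ v ((frameAt I x).E i x)) h
  rw [h1]

/-- Endomorphisms over the smooth functions act pointwise. -/
theorem apply_congr (L : SmoothField I M →ₗ[SmoothFun I M] SmoothField I M)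
    {X Y : SmoothField I M} {x : M} (h : X x = Y x) : L X x = L Y x := by
  refine ext_inner_right ℝ fun w => ?_
  obtain ⟨W, rfl⟩ := exists_field_apply_eq w
  have h1 := evalAt_congr (calculus.ip.flip W ∘ₗ L) h
  exact h1

theorem Rm_congr {X X' Y Y' Z Z' : SmoothField I M} {x : M} (hX : X x = X' x) (hY : Y x = Y' x)
    (hZ : Z x = Z' x) : calculus.Rm X Y Z x = calculus.Rm X' Y' Z' x := by
  have h1 := apply_congr (calculus.Rm X Y) hZ
  have h2 := apply_congr ((calculus.Rm X).flip Z') hY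
  have h3 := apply_congr ((LinearMap.flip calculus.Rm Y').flip Z') hX
  exact h1.trans (h2.trans h3)

/-- The covariant derivative depends only on germs. -/
theorem leviCivita_congr {Z : Π y : M, TangentSpace I y} {W : SmoothField I M} {x : M}
    (h : ∀ᶠ y in 𝓝 x, Z y = W y) : leviCivita I M Z x = leviCivita I M W x := by
  have h1 : MDiffAt (T% Z) x := (W.mdiff x).congr_of_eventuallyEq (h.mono fun y hy => by
    simp only [hy])
  exact (leviCivita I M).isCovariantDerivativeOnUniv.congr_of_eventuallyEq h1 (W.mdiff x)
    Filter.univ_mem h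

theorem curvature_congr {X Y Z : Π y : M, TangentSpace I y} {X' Y' Z' : SmoothField I M} {x : M}
    (hX : ∀ᶠ y in 𝓝 x, X y = X' y) (hY : ∀ᶠ y in 𝓝 x, Y y = Y' y)
    (hZ : ∀ᶠ y in 𝓝 x, Z y = Z' y) : curvature I X Y Z x = calculus.Rm X' Y' Z' x := by
  have h1 : ∀ᶠ y in 𝓝 x, nabla I Y Z y = nablaField Y' Z' y := by
    filter_upwards [hY, hZ.eventually_nhds] with y hy hz
    rw [nabla, leviCivita_congr hz, hy, nablaField_apply]
  have h2 : ∀ᶠ y in 𝓝 x, nabla I X Z y = nablaField X' Z' y := by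
    filter_upwards [hX, hZ.eventually_nhds] with y hy hz
    rw [nabla, leviCivita_congr hz, hy, nablaField_apply]
  have h3 : mlieBracket I X Y x = bracketField X' Y' x :=
    Filter.EventuallyEq.mlieBracket_vectorField_eq hX hY
  rw [RiemannianCalculus.Rm_apply, calculus_br]
  change leviCivita I M (nabla I Y Z) x (X x) - leviCivita I M (nabla I X Z) x (Y x)
    - leviCivita I M Z x (mlieBracket I X Y x) = leviCivita I M (nablaField Y' Z') x (X' x)
    - leviCivita I M (nablaField X' Z') x (Y' x) - leviCivita I M Z' x (bracketField X' Y' x)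
  rw [leviCivita_congr h1, leviCivita_congr h2, leviCivita_congr hZ, h3, hX.self_of_nhds,
    hY.self_of_nhds]

theorem curvatureAt_eq (X Y Z : SmoothField I M) (x : M) :
    curvatureAt I (X x) (Y x) (Z x) = calculus.Rm X Y Z x := by
  obtain ⟨X', hX⟩ := exists_field_eventuallyEq_extend (X x)
  obtain ⟨Y', hY⟩ := exists_field_eventuallyEq_extend (Y x)
  obtain ⟨Z', hZ⟩ := exists_field_eventuallyEq_extend (Z x)
  rw [curvatureAt, curvature_congr (hX.mono fun _ h => h.symm) (hY.mono fun _ h => h.symm)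
    (hZ.mono fun _ h => h.symm)]
  refine Rm_congr ?_ ?_ ?_
  · rw [hX.self_of_nhds, FiberBundle.extend_apply_self]
  · rw [hY.self_of_nhds, FiberBundle.extend_apply_self]
  · rw [hZ.self_of_nhds, FiberBundle.extend_apply_self]

theorem ricci_eq (X Y : SmoothField I M) (x : M) :
    ricci I (X x) (Y x) = evalAt x (WeakKenmotsuCalculus.ric (frameAt I x) X Y) := by
  rw [ricci, traceAt, WeakKenmotsuCalculus.ric, map_sum]
  refine Finset.sum_congr rfl fun i _ => ?_
  rw [← frameAt_apply, curvatureAt_eq]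
  rfl

end Pointwise

section AlmostContact

variable {E : Type*} [NormedAddCommGroup E] [NormedSpace ℝ E] [FiniteDimensional ℝ E]
  {H : Type*} [TopologicalSpace H] {I : ModelWithCorners ℝ E H}
  {M : Type*} [TopologicalSpace M] [ChartedSpace H M] [IsManifold I ∞ M]
  [RiemannianBundle (fun x : M => TangentSpace I x)]
  [IsContMDiffRiemannianBundle I ∞ E (fun x : M => TangentSpace I x)]

/-! ### Weak almost contact metric structures -/

namespace WeakAlmostContactMetric

variable {n : ℕ} (S : WeakAlmostContactMetric I M n)

theorem f_ξ (x : M) : S.f x (S.ξ x) = 0 := by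
  have h1 : S.f x (S.f x (S.ξ x)) = 0 := by rw [S.f_sq, S.Q_ξ, S.η_ξ, one_smul, neg_add_cancel]
  have h2 := S.f_sq x (S.f x (S.ξ x))
  rw [h1, map_zero] at h2
  have h3 : S.f x (S.ξ x) = S.η x (S.f x (S.ξ x)) • S.ξ x := by
    refine (S.Q_nonsingular x).1 ?_
    rw [map_smul, S.Q_ξ]
    linear_combination (norm := module) h2
  have h4 : S.η x (S.f x (S.ξ x)) = 0 := by
    have h5 : S.η x (S.f x (S.f x (S.ξ x))) = S.η x (S.f x (S.ξ x)) * S.η x (S.f x (S.ξ x)) := by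
      conv_lhs => rw [h3]
      rw [map_smul, map_smul, smul_eq_mul]
    rw [h1, map_zero] at h5
    exact mul_self_eq_zero.1 h5.symm
  rw [h3, h4, zero_smul]

theorem η_eq (x : M) (u : TangentSpace I x) : S.η x u = inner ℝ u (S.ξ x) := by
  have h := S.metric_f x u (S.ξ x)
  rw [S.f_ξ, inner_zero_right, S.Q_ξ, S.η_ξ] at h
  linarith

theorem η_f (x : M) (u : TangentSpace I x) : S.η x (S.f x u) = 0 := by
  have h := S.f_invariant x (u - S.η x u • S.ξ x)
    (by rw [map_sub, map_smul, S.η_ξ, smul_eq_mul, mul_one, sub_self])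
  rwa [map_sub, map_smul, S.f_ξ, smul_zero, sub_zero] at h

/-- The image of `f²` and `ξ` span the tangent space, since `Q` is surjective. -/
theorem exists_eq_f_f_add (x : M) (v : TangentSpace I x) :
    ∃ u, v = S.f x (S.f x u) + S.η x v • S.ξ x := by
  obtain ⟨w, hw⟩ := (S.Q_nonsingular x).2 v
  have h : v = S.f x (S.f x (-w)) + S.η x w • S.ξ x := by
    rw [map_neg, map_neg, S.f_sq, hw]
    abel
  refine ⟨-w, ?_⟩
  have h2 := congrArg (S.η x) h
  rw [map_add, S.η_f, zero_add, map_smul, S.η_ξ, smul_eq_mul, mul_one] at h2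
  rw [h2]
  exact h

theorem inner_f (x : M) (u v : TangentSpace I x) :
    inner ℝ (S.f x u) v = -inner ℝ u (S.f x v) := by
  obtain ⟨w, hw⟩ := S.exists_eq_f_f_add x v
  have h1 : inner ℝ (S.f x u) (S.ξ x) = 0 := by rw [← S.η_eq, S.η_f]
  have h2 : S.Q x (S.f x w) = -S.f x v := by
    have h3 := S.f_sq x (S.f x w)
    rw [S.η_f, zero_smul, add_zero] at h3
    rw [hw, map_add, map_smul, S.f_ξ, smul_zero, add_zero, h3, neg_neg]
  rw [hw, inner_add_right, inner_smul_right, h1, S.metric_f, h2, S.η_f, inner_neg_right]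
  rw [← hw]
  ring

theorem eq_of_f_eq_zero {x : M} {u : TangentSpace I x} (h : S.f x u = 0) :
    u = S.η x u • S.ξ x := by
  refine (S.Q_nonsingular x).1 ?_
  have h1 := S.f_sq x u
  rw [h, map_zero] at h1
  rw [map_smul, S.Q_ξ]
  linear_combination (norm := module) h1

/-- The field `f X`. -/
def fField (X : SmoothField I M) : SmoothField I M :=
  ⟨fun x => S.f x (X x), S.smooth_f.clm_bundle_apply X.contMDiff⟩

/-- The field `ξ` with its smoothness. -/
def ξField : SmoothField I M := ⟨S.ξ, S.smooth_ξ⟩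

variable [T2Space M]

theorem leviCivita_ξ {β : ℝ} (hS : S.IsWeakKenmotsu β) (X : SmoothField I M) (x : M) :
    leviCivita I M S.ξ x (X x) = β • (X x - S.η x (X x) • S.ξ x) := by
  have h0 := hS.2 X S.ξField X.contMDiff S.ξField.contMDiff x
  have hz : (fun y => S.f y (S.ξ y)) = 0 := funext fun y => S.f_ξ y
  have h1 : nablaEndo I S.f X S.ξ x = -S.f x (leviCivita I M S.ξ x (X x)) := by
    rw [nablaEndo, hz]
    change leviCivita I M 0 x (X x) - _ = _
    rw [show leviCivita I M 0 x = 0 from (leviCivita I M).isCovariantDerivativeOnUniv.zero]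
    simp [nabla]
  have h2 : nablaEndo I S.f X S.ξ x
      = β • (inner ℝ (S.f x (X x)) (S.ξ x) • S.ξ x - S.η x (S.ξ x) • S.f x (X x)) := h0
  rw [h1, ← S.η_eq, S.η_f, S.η_ξ, zero_smul, zero_sub, one_smul, smul_neg, neg_inj] at h2
  have h3 : S.f x (leviCivita I M S.ξ x (X x) - β • X x) = 0 := by
    rw [map_sub, map_smul, h2, sub_self]
  have h4 := S.eq_of_f_eq_zero h3
  have h5 : S.η x (leviCivita I M S.ξ x (X x)) = 0 := by
    have h6 := leviCivita_metric (X.mdiff x) (S.ξField.mdiff x) (S.ξField.mdiff x)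
    have h7 : (fun y => inner ℝ (S.ξField y) (S.ξField y)) = fun _ : M => (1 : ℝ) :=
      funext fun y => (S.η_eq y (S.ξ y)).symm.trans (S.η_ξ y)
    rw [h7, mvfderiv_const] at h6
    have h8 : (0 : ℝ) = inner ℝ (leviCivita I M S.ξ x (X x)) (S.ξ x)
      + inner ℝ (S.ξ x) (leviCivita I M S.ξ x (X x)) := h6
    rw [real_inner_comm (leviCivita I M S.ξ x (X x)) (S.ξ x)] at h8
    rw [S.η_eq]
    linarith
  rw [map_sub, map_smul, h5, smul_eq_mul, zero_sub, sub_eq_iff_eq_add] at h4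
  rw [h4]
  module

/-- A weak Kenmotsu structure obeys the rules of `WeakKenmotsuCalculus`. -/
def kenmotsuCalculus {β : ℝ} (hS : S.IsWeakKenmotsu β) :
    WeakKenmotsuCalculus (calculus (I := I) (M := M)) where
  f :=
    { toFun := S.fField
      map_add' := fun X Y => by
        ext x
        exact map_add (S.f x) (X x) (Y x)
      map_smul' := fun a X => by
        ext x
        exact map_smul (S.f x) (a x) (X x) }
  ξ := S.ξField
  β := algebraMap ℝ _ β
  D_β X := (calculus.D X).map_algebraMap β
  ip_f X Y := by
    ext x
    exact S.inner_f x (X x) (Y x)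
  f_ξ := by
    ext x
    exact S.f_ξ x
  ip_ξ_ξ := by
    ext x
    exact (S.η_eq x (S.ξ x)).symm.trans (S.η_ξ x)
  nab_f X Y := by
    ext x
    have h := hS.2 X Y X.contMDiff Y.contMDiff x
    rw [S.η_eq] at h
    exact sub_eq_iff_eq_add'.1 h
  nab_ξ X := by
    ext x
    have h := S.leviCivita_ξ hS X x
    rw [S.η_eq] at h
    exact h

variable {S} {β : ℝ} (hS : S.IsWeakKenmotsu β)

theorem starRicci_eq (X Y : SmoothField I M) (x : M) : 2 * S.starRicci (X x) (Y x)
    = evalAt x ((S.kenmotsuCalculus hS).traceForm (frameAt I x) X (S.fField Y)) := by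
  rw [starRicci, traceAt, WeakKenmotsuCalculus.traceForm, map_sum, ← mul_assoc,
    show (2 : ℝ) * (1 / 2) = 1 by norm_num, one_mul]
  refine Finset.sum_congr rfl fun i _ => ?_
  set Z := (frameAt I x).E i
  have h1 : curvatureAt I (X x) (S.f x (Y x)) (S.f x (Z x))
      = calculus.Rm X (S.fField Y) (S.fField Z) x := curvatureAt_eq X (S.fField Y) (S.fField Z) x
  have h2 := congrArg (evalAt x) (calculus.ip_Rm_swap X (S.fField Y) (S.fField Z) Z)
  have h3 := congrArg (evalAt x)
    ((S.kenmotsuCalculus hS).ip_f (calculus.Rm X (S.fField Y) Z) Z)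
  rw [← frameAt_apply, h1]
  exact h2.trans h3.symm

/-- The trace of `f ∘ R` may be taken in a single frame around each point. -/
theorem eventually_traceForm_eq (X Y : SmoothField I M) (x : M) : ∀ᶠ y in 𝓝 x,
    (S.kenmotsuCalculus hS).traceForm (frameAt I x) X Y y
      = evalAt y ((S.kenmotsuCalculus hS).traceForm (frameAt I y) X Y) := by
  filter_upwards [frameAt_orthonormal (I := I) x] with y hy
  have h := (frameAt I y).sum_eq_sum (W := (frameAt I x).E) (fun Z W => by
    have h1 := congrArg (fun v => inner ℝ (Z y) v) (Orthonormal.sum_inner_smul hy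
      (by rw [Fintype.card_fin, finrank_tangentSpace_eq x y]) (W y))
    simp only [inner_sum, inner_smul_right] at h1
    rw [← show inner ℝ (Z y) (W y) = evalAt y (calculus.ip Z W) from rfl, ← h1]
    exact Finset.sum_congr rfl fun i _ => mul_comm _ _)
    (calculus.ip ∘ₗ (S.kenmotsuCalculus hS).f ∘ₗ calculus.Rm X Y)
  have h2 : ∀ {ι : Type} [Fintype ι] (e : ι → SmoothField I M),
      (∑ i, calculus.ip ((S.kenmotsuCalculus hS).f (calculus.Rm X Y (e i))) (e i)) y
        = ∑ i, evalAt y (calculus.ip ((S.kenmotsuCalculus hS).f (calculus.Rm X Y (e i))) (e i)) :=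
    fun e => map_sum (evalAt y) _ _
  exact (h2 _).trans (h.trans (h2 _).symm)

end WeakAlmostContactMetric

end AlmostContact

section Soliton

variable {E : Type*} [NormedAddCommGroup E] [NormedSpace ℝ E] [FiniteDimensional ℝ E]
  {H : Type*} [TopologicalSpace H] {I : ModelWithCorners ℝ E H}
  {M : Type*} [TopologicalSpace M] [T2Space M] [ChartedSpace H M] [IsManifold I ∞ M]
  [RiemannianBundle (fun x : M => TangentSpace I x)]
  [IsContMDiffRiemannianBundle I ∞ E (fun x : M => TangentSpace I x)]

/-! ### Solitons of weak Kenmotsu manifolds -/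

namespace WeakAlmostContactMetric

variable {n : ℕ} {S : WeakAlmostContactMetric I M n} {β : ℝ} (hS : S.IsWeakKenmotsu β)

/-- Twice the `∗`-Ricci tensor, expressed through the soliton equation; unlike the trace in
`starRicci` this is visibly smooth. -/
def solitonTensor (V : SmoothField I M) (lam mu : ℝ) (X Y : SmoothField I M) : SmoothFun I M :=
  2 * algebraMap ℝ _ lam * calculus.ip X Y
    + 2 * algebraMap ℝ _ mu * (calculus.ip X S.ξField * calculus.ip Y S.ξField)
    - (calculus.D V (calculus.ip X Y) - calculus.ip (calculus.br V X) Y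
      - calculus.ip X (calculus.br V Y))

theorem solitonTensor_apply {V : SmoothField I M} {lam mu : ℝ}
    (hsol : S.IsStarEtaRicciSoliton V lam mu) (X Y : SmoothField I M) (x : M) :
    S.solitonTensor V lam mu X Y x
      = evalAt x ((S.kenmotsuCalculus hS).traceForm (frameAt I x) X (S.fField Y)) := by
  rw [← starRicci_eq]
  have h := hsol X Y X.contMDiff Y.contMDiff x
  rw [S.η_eq, S.η_eq] at h
  have h1 : S.solitonTensor V lam mu X Y x = 2 * lam * inner ℝ (X x) (Y x)
      + 2 * mu * (inner ℝ (X x) (S.ξ x) * inner ℝ (Y x) (S.ξ x))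
      - lieDerivMetric I V X Y x := by
    change evalAt x (S.solitonTensor V lam mu X Y) = _
    rw [solitonTensor, calculus_br, calculus_br]
    simp only [map_add, map_sub, map_mul, map_ofNat]
    rfl
  rw [h1]
  linarith

/-- The soliton equation of a weak Kenmotsu manifold obeys the rules of `ContactSoliton`. -/
theorem contactSoliton {V : SmoothField I M} {lam mu : ℝ}
    (hsol : S.IsStarEtaRicciSoliton V lam mu) {σ : SmoothFun I M} (hσ : S.IsContactWith V σ) :
    (S.kenmotsuCalculus hS).ContactSoliton V (S.solitonTensor V lam mu) (algebraMap ℝ _ lam)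
      (algebraMap ℝ _ mu) σ where
  D_lam X := (calculus.D X).map_algebraMap lam
  D_mu X := (calculus.D X).map_algebraMap mu
  soliton X Y := add_sub_cancel _ _
  contact Y := by
    have hη : ∀ Z : SmoothField I M, (fun y => S.η y (Z y)) = calculus.ip Z S.ξField :=
      fun Z => funext fun y => S.η_eq y (Z y)
    rw [calculus_br]
    ext x
    have h := hσ Y Y.contMDiff x
    rw [lieDerivForm, hη, S.η_eq, S.η_eq] at h
    exact h
  T_ξ Y := by
    ext x
    exact (S.solitonTensor_apply hS hsol S.ξField Y x).trans
      ((S.kenmotsuCalculus hS).ev_traceForm_ξ_left _ _)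
  D_ξ_T X Y := by
    ext x
    -- `starRicci` takes its trace in a basis that varies without smoothness; near `x` one smooth
    -- frame replaces it.
    have h1 : ∀ᶠ y in 𝓝 x, S.solitonTensor V lam mu X Y y
        = (S.kenmotsuCalculus hS).traceForm (frameAt I x) X (S.fField Y) y := by
      filter_upwards [eventually_traceForm_eq hS X (S.fField Y) x] with y hy
      rw [hy, solitonTensor_apply hS hsol]
    have h2 := derivFun_congr h1 S.ξField
    have h3 := (S.kenmotsuCalculus hS).ev_D_ξ_traceForm (frameAt I x) X (S.fField Y)
    have h4 : calculus.br (S.kenmotsuCalculus hS).ξ (S.fField Y)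
      = S.fField (calculus.br S.ξField Y) := (S.kenmotsuCalculus hS).br_ξ_f Y
    have h5 := solitonTensor_apply hS hsol (calculus.br S.ξField X) Y x
    have h6 := solitonTensor_apply hS hsol X (calculus.br S.ξField Y) x
    rw [h4] at h3
    refine h2.trans (h3.trans ?_)
    change _ = S.solitonTensor V lam mu (calculus.br S.ξField X) Y x
      + S.solitonTensor V lam mu X (calculus.br S.ξField Y) x
      + evalAt x (4 * (S.kenmotsuCalculus hS).β ^ 3
        * calculus.ip X ((S.kenmotsuCalculus hS).f ((S.kenmotsuCalculus hS).f Y)))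
    rw [h5, h6, map_mul, map_mul, map_ofNat]
    rfl

theorem contact_factor_eq_zero (hS : S.IsWeakKenmotsu β) {V : SmoothField I M} {lam mu : ℝ}
    (hsol : S.IsStarEtaRicciSoliton V lam mu) {σ : SmoothFun I M} (hσ : S.IsContactWith V σ)
    (hn : n ≠ 0) (x : M) : σ x = 0 := by
  obtain ⟨u, hu⟩ : ∃ u, S.f x u ≠ 0 := by
    by_contra! h
    have h1 := S.rank_f x
    have h2 : (S.f x : TangentSpace I x →ₗ[ℝ] TangentSpace I x) = 0 := LinearMap.ext h
    rw [h2, LinearMap.range_zero, finrank_bot] at h1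
    omega
  obtain ⟨X, rfl⟩ := exists_field_apply_eq u
  have h := congrArg (evalAt x) ((contactSoliton hS hsol hσ).factor_mul (S.fField X) (S.fField X))
  have h1 : 4 * β ^ 2 * σ x * (inner ℝ (S.f x (X x)) (S.f x (X x))
    - inner ℝ (S.f x (X x)) (S.ξ x) * inner ℝ (S.f x (X x)) (S.ξ x)) = 0 := by
    simp only [map_mul, map_sub, map_pow, map_ofNat, map_zero] at h
    exact h
  rw [← S.η_eq, S.η_f, mul_zero, sub_zero] at h1
  have h2 := inner_self_ne_zero (𝕜 := ℝ).2 hu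
  exact ((mul_eq_zero.1 ((mul_eq_zero.1 h1).resolve_right h2)).resolve_left
    (mul_ne_zero four_ne_zero (pow_ne_zero 2 hS.1)))

/-- Vanishing of `σ` leaves `Ric^∗(X, Y) = β² g(X, f² Y)`, so that the Ricci trace of the curvature
defect vanishes on the image of `f²`; on `ξ` it always does. -/
theorem ricDefect_eq_zero {V : SmoothField I M} {lam mu : ℝ}
    (hsol : S.IsStarEtaRicciSoliton V lam mu) {σ : SmoothFun I M} (hσ : S.IsContactWith V σ)
    (hn : n ≠ 0) (X Y : SmoothField I M) (x : M) :
    evalAt x ((S.kenmotsuCalculus hS).ricDefect (frameAt I x) X Y) = 0 := by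
  obtain ⟨w, hw⟩ := S.exists_eq_f_f_add x (Y x)
  obtain ⟨W, rfl⟩ := exists_field_apply_eq w
  let c : SmoothFun I M := algebraMap ℝ _ (S.η x (Y x))
  have hY : Y x = (S.fField (S.fField W) + c • S.ξField) x := hw
  rw [evalAt_congr _ hY, map_add, map_smul,
    show (S.kenmotsuCalculus hS).ricDefect (frameAt I x) X S.ξField = 0 from
      (S.kenmotsuCalculus hS).ricDefect_ξ (frameAt I x) X, smul_zero, add_zero]
  have h1 : 4 * β ^ 3 * inner ℝ (X x) (S.f x (S.f x (W x)))
      = 2 * β * S.solitonTensor V lam mu X W x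
        - 2 * σ x * β * (inner ℝ (X x) (W x) - inner ℝ (X x) (S.ξ x) * inner ℝ (W x) (S.ξ x)) := by
    have h := congrArg (evalAt x) ((contactSoliton hS hsol hσ).algebraic_T X W)
    simp only [map_mul, map_sub, map_pow, map_ofNat] at h
    exact h
  have h2 : evalAt x ((S.kenmotsuCalculus hS).traceForm (frameAt I x) X (S.fField W))
      = -2 * β ^ 2 * inner ℝ (S.f x (X x)) (S.f x (W x))
        - 2 * evalAt x ((S.kenmotsuCalculus hS).ricDefect (frameAt I x) X
          (S.fField (S.fField W))) :=
    (S.kenmotsuCalculus hS).ev_traceForm_f (frameAt I x) X W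
  rw [contact_factor_eq_zero hS hsol hσ hn, solitonTensor_apply hS hsol, h2, S.inner_f] at h1
  have h3 : β * evalAt x ((S.kenmotsuCalculus hS).ricDefect (frameAt I x) X
      (S.fField (S.fField W))) = 0 := by
    linear_combination h1 / 4
  exact (mul_eq_zero.1 h3).resolve_left hS.1

theorem ricci_of_contactSoliton (hS : S.IsWeakKenmotsu β) {V : SmoothField I M} {lam mu : ℝ}
    (hsol : S.IsStarEtaRicciSoliton V lam mu) {σ : SmoothFun I M} (hσ : S.IsContactWith V σ)
    (hn : n ≠ 0) (x : M) (u v : TangentSpace I x) :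
    ricci I u v = -((Module.finrank ℝ (TangentSpace I x) - 1) * β ^ 2) * inner ℝ u v := by
  obtain ⟨X, rfl⟩ := exists_field_apply_eq u
  obtain ⟨Y, rfl⟩ := exists_field_apply_eq v
  have h : evalAt x (WeakKenmotsuCalculus.ric (frameAt I x) X Y)
      = evalAt x ((S.kenmotsuCalculus hS).ricDefect (frameAt I x) X Y)
        - (Fintype.card (Fin (Module.finrank ℝ (TangentSpace I x))) - 1) * β ^ 2
          * inner ℝ (X x) (Y x) := (S.kenmotsuCalculus hS).ev_ric (frameAt I x) X Y
  rw [ricci_eq, h, ricDefect_eq_zero hS hsol hσ hn, Fintype.card_fin]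
  ring

end WeakAlmostContactMetric

end Soliton

end RiemGeom

end

theorem theorem3 {n : ℕ} (hn : 1 ≤ n)
    {M : Type*} [TopologicalSpace M] [T2Space M] [SecondCountableTopology M]
    [ChartedSpace (EuclideanSpace ℝ (Fin (2 * n + 1))) M] [IsManifold (𝓡 (2 * n + 1)) ∞ M]
    [RiemannianBundle (fun x : M => TangentSpace (𝓡 (2 * n + 1)) x)]
    [IsContMDiffRiemannianBundle (𝓡 (2 * n + 1)) ∞ (EuclideanSpace ℝ (Fin (2 * n + 1)))
      (fun x : M => TangentSpace (𝓡 (2 * n + 1)) x)]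
    (S : RiemGeom.WeakAlmostContactMetric (𝓡 (2 * n + 1)) M n) (β : ℝ) (hS : S.IsWeakKenmotsu β)
    (V : Π x : M, TangentSpace (𝓡 (2 * n + 1)) x)
    (hV : RiemGeom.IsSmoothField (𝓡 (2 * n + 1)) V) (lam mu : ℝ)
    (hsol : S.IsStarEtaRicciSoliton V lam mu)
    (σ : M → ℝ) (hσ : ContMDiff (𝓡 (2 * n + 1)) 𝓘(ℝ, ℝ) ∞ σ) (hcontact : S.IsContactWith V σ) :
    (∀ x, σ x = 0) ∧
    RiemGeom.IsEinstein (𝓡 (2 * n + 1)) M ∧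
    ∀ x : M, RiemGeom.scalarCurvature (𝓡 (2 * n + 1)) x = -(2 * n * (2 * n + 1)) * β ^ 2 := by
  let V' : RiemGeom.SmoothField (𝓡 (2 * n + 1)) M := ⟨V, hV⟩
  let σ' : RiemGeom.SmoothFun (𝓡 (2 * n + 1)) M := ⟨σ, hσ⟩
  have hsol' : S.IsStarEtaRicciSoliton V' lam mu := hsol
  have hcontact' : S.IsContactWith V' σ' := hcontact
  have hn' : n ≠ 0 := Nat.one_le_iff_ne_zero.1 hn
  have hdim : ∀ x : M, Module.finrank ℝ (TangentSpace (𝓡 (2 * n + 1)) x) = 2 * n + 1 :=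
    fun _ => finrank_euclideanSpace_fin
  have hric : ∀ (x : M) (u v : TangentSpace (𝓡 (2 * n + 1)) x),
      RiemGeom.ricci (𝓡 (2 * n + 1)) u v = -(2 * n * β ^ 2) * inner ℝ u v := fun x u v => by
    rw [RiemGeom.WeakAlmostContactMetric.ricci_of_contactSoliton hS hsol' hcontact' hn', hdim]
    push_cast
    ring
  refine ⟨RiemGeom.WeakAlmostContactMetric.contact_factor_eq_zero hS hsol' hcontact' hn',
    ⟨_, hric⟩, fun x => ?_⟩
  simp only [RiemGeom.scalarCurvature, hric, OrthonormalBasis.inner_eq_one, mul_one,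
    Finset.sum_const, Finset.card_univ, Fintype.card_fin, hdim, nsmul_eq_mul]
  push_cast
  ring
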